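/- Let $d\ge 3$, let $\mathbb S^{d-1}\subset\mathbb R^d$ be the unit sphere with rotation-invariant probability measure $\omega_{d-1}$, $\langle f_1,f_2\rangle_{\mathbb S^{d-1}}=\int f_1\overline{f_2}\,d\omega_{d-1}$, and $T^d(g)f(\eta)=f(g^{-1}\eta)$ for $g\in SO(d)$. $SO(d-1)$ is identified with the subgroup of $SO(d)$ fixing the last canonical basis vector $e^d$. Points of the sphere have spherical coordinates $\theta_1\in[0,2\pi)$, $\theta_2,\dots,\theta_{d-1}\in[0,\pi]$ with $$\eta=(\sin\theta_{d-1}\cdots\sin\theta_2\sin\theta_1,\ \sin\theta_{d-1}\cdots\sin\theta_2\cos\theta_1,\ \sin\theta_{d-1}\cdots\sin\theta_3\cos\theta_2,\ \dots,\ \cos\theta_{d-1}).$$ For $n\in\mathbb N_0$ let $\mathcal I_n^d$ be the set of $k=(k_1,\dots,k_{d-2})\in\mathbb N_0^{d-3}\times\mathbb Z$ with $n\ge k_1\ge\dots\ge k_{d-3}\ge|k_{d-2}|$ (for $d=3$: $k\in\mathbb Z$, $|k|\le n$), put $k_0=n$ and $$Y_k^{d,n}=A_k^n\prod_{j=0}^{d-3}C_{k_j-|k_{j+1}|}^{\frac{d-j-2}2+|k_{j+1}|}(\cos\theta_{d-j-1})\,\sin^{|k_{j+1}|}(\theta_{d-j-1})\;e^{ik_{d-2}\theta_1},$$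 where $C_m^\lambda$ are the Gegenbauer polynomials, $C_0^\lambda=1$, $C_1^\lambda(t)=2\lambda t$, $(m+2)C_{m+2}^\lambda(t)=2(m+1+\lambda)\,t\,C_{m+1}^\lambda(t)-(m+2\lambda)C_m^\lambda(t)$, and $A_k^n>0$ is given by $$(A_k^n)^2=\frac{2^{(d-4)(d-2)}}{\Gamma(\frac d2)}\prod_{j=0}^{d-3}\frac{2^{2|k_{j+1}|-j}(k_j-|k_{j+1}|)!\,(2k_j+d-j-2)\,\Gamma^2(\frac{d-j-2}2+|k_{j+1}|)}{\sqrt\pi\,\Gamma(k_j+|k_{j+1}|+d-j-2)}.$$ Let $\mathcal H_n^d=\mathrm{span}\{Y_k^{d,n}:k\in\mathcal I_n^d\}$ and $t_{k,l}^{d,n}(g)=\langle T^d(g)Y_l^{d,n},Y_k^{d,n}\rangle_{\mathbb S^{d-1}}$. Let $q\in\mathbb N_0$ and let $\phi\in C^q([0,\infty))$ be real-valued and non-increasing with $\phi=1$ on $[0,\frac12]$ and $\phi=0$ on $[1,\infty)$; let $\kappa(t)=\sqrt{\phi^2(t/2)-\phi^2(t)}$. Let $K\in\mathbb N_0$, $N\in\mathbb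 N=\{1,2,\dots\}$, and let $\zeta_{K,k}^{d,n}\in\mathbb C$ ($n\in\mathbb N_0$, $k\in\mathcal I_n^d$) be such that $\zeta_{K,k}^{d,n}$ is independent of $n$ for $n\ge K$, $\zeta_{K,k}^{d,n}=0$ whenever $|k_1|>K$, and $\sum_{k\in\mathcal I_n^d}|\zeta_{K,k}^{d,n}|^2=1$ for $n\ge1$. Put $$\Psi_K^N=\sum_{n=0}^\infty\sum_{k\in\mathcal I_n^d}\sqrt{\dim\mathcal H_n^d}\;\kappa\!\left(\tfrac nN\right)\zeta_{K,k}^{d,n}\,Y_k^{d,n}.$$ (All sums over $n$ have only finitely many nonzero terms.) **Proposition.** (i) Let $d\ge4$. For every $h\in SO(d-1)$, $$\langle T^d(h)\Psi_K^N,\Psi_K^N\rangle_{\mathbb S^{d-1}}=\sum_{n=0}^\infty\dim\mathcal H_n^d\;\kappa^2\!\left(\tfrac nN\right)\sum_{m=0}^{\min(K,n)}\ \sum_{k,k'\in\mathcal I_m^{d-1}}\zeta_{K,(m,k)}^{d,n}\,\overline{\zeta_{K,(m,k')}^{d,n}}\;t_{k',k}^{d-1,m}(h).$$ In particular, the auto-correlation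 function $h\mapsto\langle T^d(h)\Psi_K^N,\Psi_K^N\rangle_{\mathbb S^{d-1}}$ is the restriction to $SO(d-1)$ of a complex polynomial of degree at most $K$ in the $(d-1)^2$ matrix entries. (ii) Let $d=3$ and let $h(\gamma)\in SO(3)$ be the positive rotation by $\gamma$ in the $(x_1,x_2)$-plane. For every $\gamma\in\mathbb R$, $$\langle T^3(h(\gamma))\Psi_K^N,\Psi_K^N\rangle_{\mathbb S^2}=\sum_{n=0}^\infty\ \sum_{k=-\min(K,n)}^{\min(K,n)}\dim\mathcal H_n^3\;\kappa^2\!\left(\tfrac nN\right)|\zeta_{K,k}^{3,n}|^2\,e^{ik\gamma}.$$ In particular, the auto-correlation function is, as a function of $\gamma$, in the span of $e^{ik\gamma}$, $-K\le k\le K$. -/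

import Mathlib

open scoped ComplexConjugate

noncomputable section

namespace DirWavelet

/-! ### Spheres, rotations, spherical coordinates -/

/-- The unit sphere `𝕊^{d-1}` in the Euclidean space `ℝ^d`. -/
abbrev Sph (d : ℕ) : Type := Metric.sphere (0 : EuclideanSpace ℝ (Fin d)) 1

/-- The rotation-invariant surface measure on `𝕊^{d-1}`, normalized to total mass one. -/
def sphMeasure (d : ℕ) : MeasureTheory.Measure (Sph d) :=
  ((MeasureTheory.volume : MeasureTheory.Measure (EuclideanSpace ℝ (Fin d))).toSphere
      Set.univ)⁻¹ •
    (MeasureTheory.volume : MeasureTheory.Measure (EuclideanSpace ℝ (Fin d))).toSphere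

/-- `⟨f₁, f₂⟩ = ∫ f₁ conj(f₂) dω` on `𝕊^{d-1}`. -/
def sphInner (d : ℕ) (f₁ f₂ : Sph d → ℂ) : ℂ :=
  ∫ x, f₁ x * conj (f₂ x) ∂(sphMeasure d)

/-- The special orthogonal group `SO(d)`. -/
abbrev SO (d : ℕ) : Type := Matrix.specialOrthogonalGroup (Fin d) ℝ

theorem norm_mulVec_SO {d : ℕ} (g : SO d) (x : EuclideanSpace ℝ (Fin d)) :
    ‖(WithLp.toLp 2 ((g : Matrix (Fin d) (Fin d) ℝ).mulVec x.ofLp) :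
      EuclideanSpace ℝ (Fin d))‖ = ‖x‖ := by
  have hg : (g : Matrix (Fin d) (Fin d) ℝ).transpose * (g : Matrix (Fin d) (Fin d) ℝ) = 1 := by
    have h := (Matrix.mem_specialOrthogonalGroup_iff.1 g.2).1
    have h2 := (Matrix.mem_orthogonalGroup_iff' (Fin d) ℝ).1 h
    simpa [Matrix.star_eq_conjTranspose, Matrix.conjTranspose_eq_transpose_of_trivial] using h2
  have key : ∀ y : EuclideanSpace ℝ (Fin d), ‖y‖ ^ 2 = dotProduct y.ofLp y.ofLp := by
    intro y
    rw [EuclideanSpace.norm_sq_eq]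
    simp only [dotProduct, Real.norm_eq_abs, sq_abs]
    exact Finset.sum_congr rfl fun _ _ => sq _
  have h2 : ‖(WithLp.toLp 2 ((g : Matrix (Fin d) (Fin d) ℝ).mulVec x.ofLp) :
      EuclideanSpace ℝ (Fin d))‖ ^ 2 = ‖x‖ ^ 2 := by
    rw [key, key, Matrix.dotProduct_mulVec, ← Matrix.mulVec_transpose, Matrix.mulVec_mulVec, hg,
      Matrix.one_mulVec]
  exact (sq_eq_sq₀ (norm_nonneg _) (norm_nonneg _)).1 h2

/-- The action `(g, x) ↦ g x` of `SO(d)` on `𝕊^{d-1}`. -/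
def rot {d : ℕ} (g : SO d) (x : Sph d) : Sph d :=
  ⟨WithLp.toLp 2 ((g : Matrix (Fin d) (Fin d) ℝ).mulVec (x : EuclideanSpace ℝ (Fin d)).ofLp), by
    have hx : ‖(x : EuclideanSpace ℝ (Fin d))‖ = 1 := by simp
    rw [mem_sphere_zero_iff_norm, norm_mulVec_SO, hx]⟩

/-- The left regular representation, `T(g) f (x) = f (g⁻¹ x)`. -/
def T {d : ℕ} (g : SO d) (f : Sph d → ℂ) : Sph d → ℂ := fun x => f (rot g⁻¹ x)

/-- The point `η(θ₁, …, θ_{d-1})` with spherical coordinates `θ₁, …, θ_{d-1}`: its last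
coordinate is `cos θ_{d-1}`, …, its second one is `sin θ_{d-1} ⋯ sin θ₂ cos θ₁` and its first one
`sin θ_{d-1} ⋯ sin θ₂ sin θ₁` (the index `i : Fin d` stands for the coordinate number `i + 1`). -/
def sphPoint (d : ℕ) (θ : ℕ → ℝ) : EuclideanSpace ℝ (Fin d) :=
  WithLp.toLp 2 fun i =>
    (∏ l ∈ Finset.Ioc (i : ℕ) (d - 1), Real.sin (θ l)) *
      (if (i : ℕ) = 0 then 1 else Real.cos (θ i))

/-- The coordinate number `i + 1` of `x`, and `0` beyond the dimension. -/
def coord {d : ℕ} (x : EuclideanSpace ℝ (Fin d)) (i : ℕ) : ℝ := if h : i < d then x ⟨i, h⟩ else 0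

/-- The length of the vector of the first `i + 1` coordinates of `x`. -/
def radius {d : ℕ} (x : EuclideanSpace ℝ (Fin d)) (i : ℕ) : ℝ :=
  Real.sqrt (∑ l ∈ Finset.range (i + 1), coord x l ^ 2)

/-- Spherical coordinates `θ₁, …, θ_{d-1}` of a point; `θ₁` is normalized to `(-π, π]`, which
is as good as `[0, 2π)` because only `exp (i k θ₁)` with `k ∈ ℤ` is used. See
`sphPoint_angle`. -/
def angle {d : ℕ} (x : EuclideanSpace ℝ (Fin d)) (i : ℕ) : ℝ :=
  if i = 1 then Complex.arg (coord x 1 + coord x 0 * Complex.I)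
  else Real.arccos (coord x i / radius x i)

theorem radius_nonneg {d : ℕ} (x : EuclideanSpace ℝ (Fin d)) (i : ℕ) : 0 ≤ radius x i :=
  Real.sqrt_nonneg _

theorem radius_sq {d : ℕ} (x : EuclideanSpace ℝ (Fin d)) (i : ℕ) :
    radius x i ^ 2 = ∑ l ∈ Finset.range (i + 1), coord x l ^ 2 :=
  Real.sq_sqrt (Finset.sum_nonneg fun _ _ => sq_nonneg _)

theorem radius_sq_succ {d : ℕ} (x : EuclideanSpace ℝ (Fin d)) (i : ℕ) :
    radius x (i + 1) ^ 2 = radius x i ^ 2 + coord x (i + 1) ^ 2 := by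
  rw [radius_sq, radius_sq, Finset.sum_range_succ _ (i + 1)]

theorem abs_coord_le_radius {d : ℕ} (x : EuclideanSpace ℝ (Fin d)) (i : ℕ) :
    |coord x i| ≤ radius x i := by
  apply Real.abs_le_sqrt
  exact Finset.single_le_sum (f := fun l => coord x l ^ 2) (fun _ _ => sq_nonneg _)
    (Finset.self_mem_range_succ i)

theorem radius_mul_cos {d : ℕ} (x : EuclideanSpace ℝ (Fin d)) {i : ℕ} (hi : 2 ≤ i) :
    radius x i * Real.cos (angle x i) = coord x i := by
  have h1 : i ≠ 1 := by omega
  have hb := abs_le.1 (abs_coord_le_radius x i)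
  rcases (radius_nonneg x i).eq_or_lt with h | h
  · have : coord x i = 0 := by
      have := abs_coord_le_radius x i
      rw [← h] at this
      exact abs_nonpos_iff.1 this
    rw [← h, this, zero_mul]
  · rw [angle, if_neg h1, Real.cos_arccos]
    · field_simp
    · rw [le_div_iff₀ h]; linarith [hb.1]
    · rw [div_le_iff₀ h]; linarith [hb.2]

theorem radius_mul_sin {d : ℕ} (x : EuclideanSpace ℝ (Fin d)) {i : ℕ} (hi : 1 ≤ i) :
    radius x (i + 1) * Real.sin (angle x (i + 1)) = radius x i := by
  have hs : 0 ≤ Real.sin (angle x (i + 1)) := by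
    rw [angle, if_neg (by omega)]
    exact Real.sin_nonneg_of_nonneg_of_le_pi (Real.arccos_nonneg _) (Real.arccos_le_pi _)
  have hc := radius_mul_cos x (i := i + 1) (by omega)
  have hr := radius_sq_succ x i
  rw [← sq_eq_sq₀ (mul_nonneg (radius_nonneg _ _) hs) (radius_nonneg _ _), mul_pow,
    Real.sin_sq]
  have : radius x (i + 1) ^ 2 * Real.cos (angle x (i + 1)) ^ 2 = coord x (i + 1) ^ 2 := by
    rw [← mul_pow, hc]
  linarith

/-- The angles of a point of the sphere are spherical coordinates of it. -/
theorem sphPoint_angle {d : ℕ} (hd : 2 ≤ d) (x : Sph d) :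
    sphPoint d (angle (x : EuclideanSpace ℝ (Fin d))) = x := by
  obtain ⟨x, hx⟩ := x
  change sphPoint d (angle x) = x
  have hx1 : ‖x‖ = 1 := by simpa using hx
  have htop : radius x (d - 1) = 1 := by
    have : radius x (d - 1) ^ 2 = 1 := by
      rw [radius_sq, Nat.sub_add_cancel (by omega), ← Fin.sum_univ_eq_sum_range
        (fun l => coord x l ^ 2)]
      have h2 := EuclideanSpace.norm_sq_eq x
      rw [hx1] at h2
      simpa [coord] using h2.symm
    nlinarith [radius_nonneg x (d - 1)]
  have hprod : ∀ n i, 1 ≤ i → i + n = d - 1 →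
      ∏ l ∈ Finset.Ioc i (d - 1), Real.sin (angle x l) = radius x i := by
    intro n
    induction n with
    | zero => intro i _ h; rw [← h] at htop ⊢; simpa using htop.symm
    | succ n ih =>
      intro i h1 h
      have hI : Finset.Ioc i (d - 1) = insert (i + 1) (Finset.Ioc (i + 1) (d - 1)) := by
        ext l
        simp only [Finset.mem_Ioc, Finset.mem_insert]
        omega
      rw [hI, Finset.prod_insert (by simp), ih (i + 1) (by omega) (by omega), mul_comm]
      exact radius_mul_sin x h1
  have hz : ‖(coord x 1 + coord x 0 * Complex.I : ℂ)‖ = radius x 1 := by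
    rw [Complex.norm_add_mul_I, radius, Finset.sum_range_succ, Finset.sum_range_one, add_comm]
  have hz1 : radius x 1 * Real.cos (angle x 1) = coord x 1 := by
    rw [← hz, angle, if_pos rfl, Complex.norm_mul_cos_arg]
    simp
  have hz0 : radius x 1 * Real.sin (angle x 1) = coord x 0 := by
    rw [← hz, angle, if_pos rfl, Complex.norm_mul_sin_arg]
    simp
  ext i
  have hi : coord x i = x i := by simp [coord]
  rw [← hi]
  change (∏ l ∈ Finset.Ioc (i : ℕ) (d - 1), Real.sin (angle x l)) *
      (if (i : ℕ) = 0 then 1 else Real.cos (angle x i)) = _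
  have hid := i.2
  generalize (i : ℕ) = m at hid ⊢
  rcases m with _ | m
  · have hI : Finset.Ioc 0 (d - 1) = insert 1 (Finset.Ioc 1 (d - 1)) := by
      ext l
      simp only [Finset.mem_Ioc, Finset.mem_insert]
      omega
    rw [hI, Finset.prod_insert (by simp), hprod (d - 2) 1 le_rfl (by omega), if_pos rfl, mul_one,
      mul_comm]
    exact hz0
  · rw [if_neg (by omega), hprod (d - 1 - (m + 1)) (m + 1) (by omega) (by omega)]
    rcases m with _ | m
    · exact hz1
    · exact radius_mul_cos x (by omega)

/-! ### Spherical harmonics -/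

/-- The Gegenbauer polynomials `C_m^λ`, by their three-term recurrence
`(m+2) C_{m+2}^λ(t) = 2 (m+1+λ) t C_{m+1}^λ(t) - (m+2λ) C_m^λ(t)`. -/
def gegenbauer (lam : ℝ) : ℕ → Polynomial ℝ
  | 0 => 1
  | 1 => Polynomial.C (2 * lam) * Polynomial.X
  | m + 2 => Polynomial.C (1 / ((m : ℝ) + 2)) *
      (Polynomial.C (2 * ((m : ℝ) + 1 + lam)) * Polynomial.X * gegenbauer lam (m + 1) -
        Polynomial.C ((m : ℝ) + 2 * lam) * gegenbauer lam m)

/-- Multi-indices `k = (k₁, …, k_{d-2})` of integers; `k₁` is the value at `0 : Fin (d - 2)`. -/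
abbrev Idx (d : ℕ) : Type := Fin (d - 2) → ℤ

/-- The entry `k_j` of a multi-index, where `k₀ = n`. -/
def ent {d : ℕ} (n : ℕ) (k : Idx d) : ℕ → ℤ
  | 0 => n
  | j + 1 => if h : j < d - 2 then k ⟨j, h⟩ else 0

/-- The finite set `𝓘_n^d` of all `k ∈ ℤ^{d-2}` with
`n ≥ k₁ ≥ ⋯ ≥ k_{d-3} ≥ |k_{d-2}|` and `k₁, …, k_{d-3} ≥ 0`. -/
def idxSet (d n : ℕ) : Finset (Idx d) :=
  (Fintype.piFinset fun _ => Finset.Icc (-(n : ℤ)) n).filter fun k =>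
    ∀ j < d - 2, |ent n k (j + 1)| ≤ ent n k j

/-- The box in the definition of `idxSet` is no restriction. -/
theorem mem_idxSet {d n : ℕ} {k : Idx d} :
    k ∈ idxSet d n ↔ ∀ j < d - 2, |ent n k (j + 1)| ≤ ent n k j := by
  refine ⟨fun h => (Finset.mem_filter.1 h).2, fun h => Finset.mem_filter.2 ⟨?_, h⟩⟩
  have hb : ∀ j, j ≤ d - 2 → |ent n k j| ≤ n := by
    intro j
    induction j with
    | zero => intro _; simp [ent]
    | succ j ih =>
      intro hj
      exact (h j (by omega)).trans ((le_abs_self _).trans (ih (by omega)))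
  rw [Fintype.mem_piFinset]
  intro i
  have := hb (i + 1) (by omega)
  simp only [ent, i.2, dif_pos] at this
  exact Finset.mem_Icc.2 (abs_le.1 this)

/-- The square `(A_k^n)²` of the normalization factor. -/
def normSq (d n : ℕ) (k : Idx d) : ℝ :=
  (2 : ℝ) ^ (((d : ℤ) - 4) * ((d : ℤ) - 2)) / Real.Gamma ((d : ℝ) / 2) *
    ∏ j ∈ Finset.range (d - 2),
      (2 : ℝ) ^ (2 * |ent n k (j + 1)| - (j : ℤ)) *
          ((ent n k j - |ent n k (j + 1)|).toNat.factorial : ℝ) *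
          (2 * (ent n k j : ℝ) + d - j - 2) *
          Real.Gamma (((d : ℝ) - j - 2) / 2 + |(ent n k (j + 1) : ℝ)|) ^ 2 /
        (Real.sqrt Real.pi *
          Real.Gamma ((ent n k j : ℝ) + |(ent n k (j + 1) : ℝ)| + d - j - 2))

/-- The spherical harmonic `Y_k^{d,n}` as a function of the spherical coordinates,
`A_k^n ∏_{j=0}^{d-3} C_{k_j-|k_{j+1}|}^{(d-j-2)/2+|k_{j+1}|}(cos θ_{d-j-1})
sin^{|k_{j+1}|}(θ_{d-j-1}) e^{i k_{d-2} θ₁}`. -/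
def harmonicAng (d n : ℕ) (k : Idx d) (θ : ℕ → ℝ) : ℂ :=
  (Real.sqrt (normSq d n k) : ℂ) *
    (∏ j ∈ Finset.range (d - 2),
      (((gegenbauer (((d : ℝ) - j - 2) / 2 + |(ent n k (j + 1) : ℝ)|)
            (ent n k j - |ent n k (j + 1)|).toNat).eval (Real.cos (θ (d - j - 1))) *
          Real.sin (θ (d - j - 1)) ^ (ent n k (j + 1)).natAbs : ℝ) : ℂ)) *
    Complex.exp (Complex.I * (ent n k (d - 2) : ℂ) * (θ 1 : ℂ))

/-- The spherical harmonic `Y_k^{d,n}` as a function on `𝕊^{d-1}`. -/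
def harmonic (d n : ℕ) (k : Idx d) (x : Sph d) : ℂ :=
  harmonicAng d n k (angle (x : EuclideanSpace ℝ (Fin d)))

/-- The space `𝓗_n^d` of spherical harmonics of degree `n`. -/
def harmonicSpace (d n : ℕ) : Submodule ℂ (Sph d → ℂ) :=
  Submodule.span ℂ (harmonic d n '' (idxSet d n : Set (Idx d)))

/-- `dim 𝓗_n^d`. -/
def dimHarm (d n : ℕ) : ℕ := Module.finrank ℂ (harmonicSpace d n)

/-- The matrix coefficient `t_{k,l}^{d,n}(g) = ⟨T(g) Y_l^{d,n}, Y_k^{d,n}⟩`. -/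
def matCoeff (d n : ℕ) (k l : Idx d) (g : SO d) : ℂ :=
  sphInner d (T g (harmonic d n l)) (harmonic d n k)

/-! ### Directional wavelets -/

/-- `φ ∈ C^q([0, ∞))` is non-increasing, equal to `1` on `[0, 1/2]` and to `0` on `[1, ∞)`. -/
structure IsProfile (q : ℕ) (φ : ℝ → ℝ) : Prop where
  contDiffOn : ContDiffOn ℝ q φ (Set.Ici 0)
  antitoneOn : AntitoneOn φ (Set.Ici 0)
  eq_one : ∀ t, 0 ≤ t → t ≤ 1 / 2 → φ t = 1
  eq_zero : ∀ t, 1 ≤ t → φ t = 0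

/-- The window `κ(t) = (φ²(t/2) - φ²(t))^{1/2}`. -/
def kappa (φ : ℝ → ℝ) (t : ℝ) : ℝ := Real.sqrt (φ (t / 2) ^ 2 - φ t ^ 2)

/-- The conditions on the directionality components `ζ_{K,k}^{d,n}`, written `ζ n k`: they do
not depend on `n` for `n ≥ K`, vanish if `|k₁| > K`, and have `ℓ²`-norm one for each `n ≥ 1`. -/
structure IsDirectionality (d K : ℕ) (ζ : ℕ → Idx d → ℂ) : Prop where
  indep : ∀ n n' : ℕ, K ≤ n → K ≤ n' → ∀ k ∈ idxSet d n, k ∈ idxSet d n' → ζ n k = ζ n' k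
  support : ∀ n : ℕ, ∀ k ∈ idxSet d n, (K : ℤ) < |ent n k 1| → ζ n k = 0
  norm_one : ∀ n : ℕ, 1 ≤ n → ∑ k ∈ idxSet d n, ‖ζ n k‖ ^ 2 = 1

/-- The wavelet `Ψ_K^N = ∑_n ∑_{k ∈ 𝓘_n^d} (dim 𝓗_n^d)^{1/2} κ(n/N) ζ_{K,k}^{d,n} Y_k^{d,n}`
(only finitely many `n` contribute, see `kappa_eq_zero`). -/
def wavelet (d : ℕ) (φ : ℝ → ℝ) (ζ : ℕ → Idx d → ℂ) (N : ℕ) (x : Sph d) : ℂ :=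
  ∑' n : ℕ, ∑ k ∈ idxSet d n,
    (Real.sqrt (dimHarm d n) : ℂ) * (kappa φ ((n : ℝ) / N) : ℂ) * ζ n k * harmonic d n k x

theorem kappa_eq_zero {q : ℕ} {φ : ℝ → ℝ} (hφ : IsProfile q φ) {t : ℝ} (ht : 2 ≤ t) :
    kappa φ t = 0 := by
  rw [kappa, hφ.eq_zero t (by linarith), hφ.eq_zero (t / 2) (by linarith)]
  simp

/-! ### Subgroups, multi-indices and polynomials for the statement -/

/-- The matrix of `h` acting on the first `d - 1` coordinates and fixing `e^d`. -/
def extMatrix {d : ℕ} (h : Matrix (Fin (d - 1)) (Fin (d - 1)) ℝ) : Matrix (Fin d) (Fin d) ℝ :=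
  fun i j =>
    if hij : (i : ℕ) < d - 1 ∧ (j : ℕ) < d - 1 then h ⟨i, hij.1⟩ ⟨j, hij.2⟩
    else if i = j then 1 else 0

theorem extMatrix_mem {d : ℕ} (h : SO (d - 1)) :
    extMatrix (d := d) (h : Matrix (Fin (d - 1)) (Fin (d - 1)) ℝ) ∈
      Matrix.specialOrthogonalGroup (Fin d) ℝ := by
  rcases d with _ | d
  · rw [Matrix.mem_specialOrthogonalGroup_iff, Matrix.mem_orthogonalGroup_iff]
    exact ⟨Subsingleton.elim _ _, Matrix.det_isEmpty⟩
  · have hA := Matrix.mem_specialOrthogonalGroup_iff.1 h.2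
    have hA1 := (Matrix.mem_orthogonalGroup_iff (Fin d) ℝ).1 hA.1
    have hA2 := hA.2
    change SO d at h
    have hE : extMatrix (d := d + 1) (h : Matrix (Fin d) (Fin d) ℝ) =
        Matrix.reindex finSumFinEquiv finSumFinEquiv
          (Matrix.fromBlocks (h : Matrix (Fin d) (Fin d) ℝ) 0 0
            (1 : Matrix (Fin 1) (Fin 1) ℝ)) := by
      ext i j
      obtain ⟨i, rfl⟩ := (finSumFinEquiv (m := d) (n := 1)).surjective i
      obtain ⟨j, rfl⟩ := (finSumFinEquiv (m := d) (n := 1)).surjective j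
      rcases i with i | i <;> rcases j with j | j
      · simp [extMatrix]
      · have hij : ¬ (Fin.castAdd 1 i = Fin.natAdd d j) := by
          simp only [Fin.ext_iff, Fin.val_castAdd, Fin.val_natAdd]; omega
        simp [extMatrix, hij]
      · have hij : ¬ (Fin.natAdd d i = Fin.castAdd 1 j) := by
          simp only [Fin.ext_iff, Fin.val_castAdd, Fin.val_natAdd]; omega
        simp [extMatrix, hij]
      · have hij : i = j := Subsingleton.elim _ _
        simp [extMatrix, hij]
    rw [hE, Matrix.mem_specialOrthogonalGroup_iff, Matrix.mem_orthogonalGroup_iff]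
    refine ⟨?_, ?_⟩
    · rw [Matrix.transpose_reindex,
        Matrix.fromBlocks_transpose, Matrix.reindex_apply, Matrix.reindex_apply,
        Matrix.submatrix_mul_equiv, Matrix.fromBlocks_multiply]
      have hA1' : (h : Matrix (Fin d) (Fin d) ℝ) * (h : Matrix (Fin d) (Fin d) ℝ).transpose
        = 1 := hA1
      simp [hA1']
    · rw [Matrix.reindex_apply, Matrix.det_submatrix_equiv_self,
        Matrix.det_fromBlocks_zero₂₁]
      have hA2' : (h : Matrix (Fin d) (Fin d) ℝ).det = 1 := hA2
      simp [hA2']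

/-- `SO(d-1)` as the subgroup of `SO(d)` that fixes `e^d`. -/
def emb {d : ℕ} (h : SO (d - 1)) : SO d := ⟨extMatrix (d := d) h, extMatrix_mem h⟩

/-- The rotation `h(γ) ∈ SO(3)` by `γ` in the positive sense in the `(x₁, x₂)`-plane. -/
def planeRot (γ : ℝ) : SO 3 :=
  ⟨!![Real.cos γ, -Real.sin γ, 0; Real.sin γ, Real.cos γ, 0; 0, 0, 1], by
    rw [Matrix.mem_specialOrthogonalGroup_iff, Matrix.mem_orthogonalGroup_iff]
    have h := Real.sin_sq_add_cos_sq γ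
    refine ⟨?_, ?_⟩
    · ext i j
      fin_cases i <;> fin_cases j <;>
        simp [Matrix.mul_apply, Fin.sum_univ_three] <;> nlinarith
    · rw [Matrix.det_fin_three]
      simp
      nlinarith⟩

/-- The multi-index `(m, k) = (m, k₁, …, k_{d-3})` for `k = (k₁, …, k_{d-3})`. -/
def consIdx {d : ℕ} (m : ℤ) (k : Idx (d - 1)) : Idx d := fun i =>
  if h : (i : ℕ) = 0 then m else k ⟨(i : ℕ) - 1, by omega⟩

/-- The auto-correlation function `h ↦ ⟨T(h) Ψ_K^N, Ψ_K^N⟩`, at an element of `SO(d)`. -/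
def autocorr (d : ℕ) (φ : ℝ → ℝ) (ζ : ℕ → Idx d → ℂ) (N : ℕ) (h : SO d) : ℂ :=
  sphInner d (T h (wavelet d φ ζ N)) (wavelet d φ ζ N)

/-- `Π_K(SO(d))`: the restrictions to `SO(d)` of the complex polynomials of degree at most `K`
in the `d²` matrix entries. -/
def IsPolySO (d K : ℕ) (f : SO d → ℂ) : Prop :=
  ∃ p : MvPolynomial (Fin d × Fin d) ℂ, p.totalDegree ≤ K ∧
    ∀ g : SO d, f g =
      MvPolynomial.eval (fun ij => ((g : Matrix (Fin d) (Fin d) ℝ) ij.1 ij.2 : ℂ)) p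

/-- `Π_K(SO(2))`, as functions of the rotation angle: the span of `γ ↦ e^{ikγ}`, `|k| ≤ K`. -/
def trigPoly (K : ℕ) : Submodule ℂ (ℝ → ℂ) :=
  Submodule.span ℂ
    ((fun (k : ℤ) (γ : ℝ) => Complex.exp (Complex.I * (k : ℂ) * (γ : ℂ))) ''
      Set.Icc (-(K : ℤ)) K)

end DirWavelet

end

open DirWavelet

open scoped ComplexConjugate

noncomputable section

namespace DirWavelet

section GegenbauerIntegrals

open Polynomial

/-! ### Beta moments and Gegenbauer polynomials -/

/-! The proof is a recursion over the dimension. Up to normalization, the harmonic with index `(m,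
k)` and degree `n` on the sphere of `ℝ^{e+1}` is `C_{n-m}^{(e-1)/2+m}` of the last coordinate, times
the homogeneous polynomial of degree `m` extending the harmonic with index `k` on the sphere of
`ℝ^e`, taken at the other coordinates (`harmonicAng_consIdx`, `IsSolid.step`). A rotation fixing the
last basis vector touches only those other coordinates. Hence the inner product of a rotated
harmonic with another one splits (`sphInner_stepAng`) into a weighted Gegenbauer integral over `[-1,
1]`, which gives orthogonality and the value of `A_k^n`, and an integral over the smaller sphere,
which is a matrix coefficient if `m = m'` and zero otherwise. In the quadruple sum for the
auto-correlation only `n = n'`, `m = m'` survive, and the support condition on `ζ` cuts off at `m ≤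
K`.

Sphere integrals of homogeneous polynomials are computed from Gaussian integrals: polar coordinates
relate them to the sphere, and the Gaussian factors over the coordinates. This gives the slicing
formula `IsHom.integral_sphere_slice`, invariance under rotations and vanishing in odd degree. The
weighted integrals over `[-1, 1]` are encoded as the linear functional `betaInt`, defined by its
moments.

Orthogonality between degrees comes from `IsOrthLower`: it holds for the Fourier modes on the circle
and passes from one dimension to the next by `IsHom.orthLower_slice`.

For the polynomial statement, a harmonic of degree `m` is a polynomial of degree `m` and `h⁻¹` is
the transpose of `h`, so its matrix coefficients have degree at most `m ≤ K` in the entries of `h`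
(`isPolySO_matCoeff`). For `d = 3` the smaller sphere is the circle, where a rotation multiplies
`circFun k` by `e^{ikγ}`. -/

/-- The moments `∫_{-1}^1 t^a (1 - t²)^{μ - 1} dt`. -/
def betaMoment (μ : ℝ) (a : ℕ) : ℝ :=
  if Even a then
    Real.Gamma μ * Real.Gamma (((a : ℝ) + 1) / 2) / Real.Gamma (μ + ((a : ℝ) + 1) / 2)
  else 0

theorem betaMoment_add_two {μ : ℝ} (hμ : 0 < μ) (a : ℕ) :
    (2 * μ + a + 1) * betaMoment μ (a + 2) = (a + 1) * betaMoment μ a := by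
  unfold betaMoment
  have hev : Even (a + 2) ↔ Even a := by simp [Nat.even_add]
  by_cases h : Even a
  · rw [if_pos h, if_pos (hev.2 h)]
    have h1 : (((a + 2 : ℕ) : ℝ) + 1) / 2 = ((a : ℝ) + 1) / 2 + 1 := by push_cast; ring
    have hp : 0 < ((a : ℝ) + 1) / 2 := by positivity
    have h2 : μ + (((a : ℝ) + 1) / 2 + 1) = (μ + ((a : ℝ) + 1) / 2) + 1 := by ring
    have hG := (Real.Gamma_pos_of_pos (add_pos hμ hp)).ne'
    rw [h1, h2, Real.Gamma_add_one hp.ne', Real.Gamma_add_one (add_pos hμ hp).ne']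
    have h3 := (add_pos hμ hp).ne'
    field_simp
    ring
  · rw [if_neg h, if_neg (fun h' => h (hev.1 h'))]; simp

theorem betaMoment_add_one {μ : ℝ} (hμ : 0 < μ) (a : ℕ) :
    betaMoment (μ + 1) a = betaMoment μ a - betaMoment μ (a + 2) := by
  have h0 := betaMoment_add_two hμ a
  have hk : (2 * μ + a + 1) * betaMoment (μ + 1) a = 2 * μ * betaMoment μ a := by
    unfold betaMoment
    by_cases h : Even a
    · rw [if_pos h, if_pos h]
      have hp : 0 < ((a : ℝ) + 1) / 2 := by positivity
      have h2 : μ + 1 + ((a : ℝ) + 1) / 2 = (μ + ((a : ℝ) + 1) / 2) + 1 := by ring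
      have hG := (Real.Gamma_pos_of_pos (add_pos hμ hp)).ne'
      rw [h2, Real.Gamma_add_one hμ.ne', Real.Gamma_add_one (add_pos hμ hp).ne']
      have h3 := (add_pos hμ hp).ne'
      field_simp
      ring
    · simp [if_neg h]
  have h3 : (2 * μ + a + 1) ≠ 0 := by positivity
  apply mul_left_cancel₀ h3
  linear_combination hk + h0

/-- The functional `p ↦ ∫_{-1}^1 p(t) (1 - t²)^{μ - 1} dt`. -/
def betaInt (μ : ℝ) : ℝ[X] →ₗ[ℝ] ℝ :=
  Polynomial.lsum fun a => LinearMap.mulRight ℝ (betaMoment μ a)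

theorem betaInt_monomial (μ : ℝ) (a : ℕ) (c : ℝ) :
    betaInt μ (monomial a c) = c * betaMoment μ a := by
  simp [betaInt, Polynomial.lsum_apply, Polynomial.sum_monomial_index]

theorem betaInt_C_mul (μ c : ℝ) (p : ℝ[X]) : betaInt μ (C c * p) = c * betaInt μ p := by
  rw [← smul_eq_C_mul, map_smul, smul_eq_mul]

/-- Integration by parts: the argument times `(1 - t²)^{μ-1}` is the derivative of `(1 - t²)^μ
p(t)`, which vanishes at `±1`. On monomials this is exactly `betaMoment_add_two`. -/
theorem betaInt_deriv {μ : ℝ} (hμ : 0 < μ) (p : ℝ[X]) :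
    betaInt μ ((1 - X ^ 2) * derivative p - C (2 * μ) * (X * p)) = 0 := by
  induction p using Polynomial.induction_on' with
  | add p q hp hq =>
    rw [← add_zero (0 : ℝ)]
    nth_rw 1 [← hp]
    rw [← hq, ← map_add]
    congr 1
    simp only [derivative_add]
    ring
  | monomial n c =>
    rcases n with _ | n
    · have : (1 - X ^ 2) * derivative (monomial 0 c) - C (2 * μ) * (X * monomial 0 c)
          = monomial 1 (-(2 * μ * c)) := by
        rw [← C_mul_X_pow_eq_monomial, ← C_mul_X_pow_eq_monomial]
        simp
        ring
      rw [this, betaInt_monomial]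
      simp [betaMoment]
    · have : (1 - X ^ 2) * derivative (monomial (n + 1) c) - C (2 * μ) * (X * monomial (n + 1) c)
          = monomial n (c * (n + 1)) - monomial (n + 2) (c * (n + 1 + 2 * μ)) := by
        rw [← C_mul_X_pow_eq_monomial, ← C_mul_X_pow_eq_monomial, ← C_mul_X_pow_eq_monomial]
        simp
        ring
      rw [this, map_sub, betaInt_monomial, betaInt_monomial]
      linear_combination (-c) * betaMoment_add_two hμ n

theorem betaInt_add_one {μ : ℝ} (hμ : 0 < μ) (p : ℝ[X]) :
    betaInt (μ + 1) p = betaInt μ ((1 - X ^ 2) * p) := by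
  induction p using Polynomial.induction_on' with
  | add p q hp hq => rw [map_add, hp, hq, mul_add, map_add]
  | monomial n c =>
    have : (1 - X ^ 2) * monomial n c = monomial n c - monomial (n + 2) c := by
      rw [← C_mul_X_pow_eq_monomial, ← C_mul_X_pow_eq_monomial]
      ring
    rw [this, map_sub, betaInt_monomial, betaInt_monomial, betaInt_monomial, betaMoment_add_one hμ]
    ring

/-- Raising `μ` by `s` multiplies the weight by `(1 - t²)^s`. This allows weights with different
parameters to be compared in `IsHom.orthLower_slice`. -/
theorem betaInt_add_nat {μ : ℝ} (hμ : 0 < μ) (s : ℕ) (p : ℝ[X]) :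
    betaInt (μ + s) p = betaInt μ ((1 - X ^ 2) ^ s * p) := by
  induction s generalizing p with
  | zero => simp
  | succ s ih =>
    rw [Nat.cast_succ, ← add_assoc, betaInt_add_one (by positivity), ih, pow_succ _ s, mul_assoc]

/-! ### Recurrence, orthogonality and norms of the Gegenbauer polynomials -/

theorem gegenbauer_rec (lam : ℝ) (m : ℕ) :
    C ((m : ℝ) + 2) * gegenbauer lam (m + 2) =
      C (2 * ((m : ℝ) + 1 + lam)) * X * gegenbauer lam (m + 1) -
        C ((m : ℝ) + 2 * lam) * gegenbauer lam m := by
  rw [gegenbauer, ← mul_assoc, ← C_mul]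
  have : ((m : ℝ) + 2) * (1 / ((m : ℝ) + 2)) = 1 := by field_simp
  rw [this, C_1, one_mul]

theorem gegenbauer_rec_one (lam : ℝ) :
    gegenbauer lam 1 = C (2 * lam) * X * gegenbauer lam 0 := by
  simp [gegenbauer]

/-- The first order differential relations between consecutive Gegenbauer polynomials. -/
theorem gegenbauer_deriv (lam : ℝ) (m : ℕ) :
    (1 - X ^ 2) * derivative (gegenbauer lam m) =
      C ((m : ℝ) + 2 * lam) * X * gegenbauer lam m - C ((m : ℝ) + 1) * gegenbauer lam (m + 1) ∧
    (1 - X ^ 2) * derivative (gegenbauer lam (m + 1)) =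
      C ((m : ℝ) + 2 * lam) * gegenbauer lam m - C ((m : ℝ) + 1) * X * gegenbauer lam (m + 1) := by
  induction m with
  | zero =>
    constructor
    · simp [gegenbauer]
    · simp [gegenbauer]
      ring
  | succ m ih =>
    obtain ⟨h1, h2⟩ := ih
    have hr := gegenbauer_rec lam m
    have hb : (1 - X ^ 2) * derivative (gegenbauer lam (m + 1)) =
      C (((m + 1 : ℕ) : ℝ) + 2 * lam) * X * gegenbauer lam (m + 1)
        - C (((m + 1 : ℕ) : ℝ) + 1) * gegenbauer lam (m + 1 + 1) := by
      rw [h2]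
      simp only [C_add, C_mul, C_ofNat, C_1, Nat.cast_succ, map_natCast] at hr ⊢
      linear_combination hr
    refine ⟨hb, ?_⟩
    have hm : C ((m : ℝ) + 2) ≠ 0 := by
      rw [Ne, C_eq_zero]; positivity
    apply mul_left_cancel₀ hm
    -- Differentiate the recurrence. The coefficient `2(m+1+λ)` of `X C'_{m+1}` splits as `(m+2) +
    -- (m+2λ)`: the first share is rewritten by `hb`, the second by `h2`.
    have hd := congrArg derivative hr
    simp only [derivative_sub, derivative_mul, derivative_C, derivative_X, zero_mul, zero_add] at hd
    simp only [C_add, C_mul, C_ofNat, C_1, Nat.cast_succ, map_natCast] at hd hb h1 h2 ⊢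
    linear_combination (1 - X ^ 2) * hd + ((m : ℝ[X]) + 2) * X * hb - (C lam * 2 + m) * h1
      + X * (m + 2 * C lam) * h2

/-- Integration by parts applied to the two relations of `gegenbauer_deriv` gives `ha` and `hb`,
which link the integrals of `C_{m+2}`, `X C_{m+1}` and `C_m`. The induction has step two: degree one
vanishes by parity, and degree two because the factor `m - 1` in `ha` is zero at `m = 1`. -/
theorem betaInt_gegenbauer_eq_zero {lam : ℝ} (hl : 0 < lam) (m : ℕ) :
    betaInt (lam + 1 / 2) (gegenbauer lam (m + 1)) = 0 := by
  have hμ : 0 < lam + 1 / 2 := by positivity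
  have ha : ∀ m : ℕ, ((m : ℝ) + 1) * betaInt (lam + 1 / 2) (gegenbauer lam (m + 1)) =
      ((m : ℝ) - 1) * betaInt (lam + 1 / 2) (X * gegenbauer lam m) := by
    intro m
    have h := betaInt_deriv hμ (gegenbauer lam m)
    rw [(gegenbauer_deriv lam m).1, mul_assoc] at h
    simp only [map_sub, betaInt_C_mul] at h
    linear_combination -h
  have hb : ∀ m : ℕ, ((m : ℝ) + 2 * lam) * betaInt (lam + 1 / 2) (gegenbauer lam m) =
      ((m : ℝ) + 2 + 2 * lam) * betaInt (lam + 1 / 2) (X * gegenbauer lam (m + 1)) := by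
    intro m
    have h := betaInt_deriv hμ (gegenbauer lam (m + 1))
    rw [(gegenbauer_deriv lam m).2, mul_assoc] at h
    simp only [map_sub, betaInt_C_mul] at h
    linear_combination h
  have hstep : ∀ m : ℕ, (m = 0 ∨ betaInt (lam + 1 / 2) (gegenbauer lam m) = 0) →
      betaInt (lam + 1 / 2) (gegenbauer lam (m + 2)) = 0 := by
    intro m hm
    have h1 := ha (m + 1)
    have h2 := hb m
    rcases hm with rfl | hm
    · have : ((0 + 1 : ℕ) : ℝ) - 1 = 0 := by norm_num
      rw [this, zero_mul] at h1
      refine (mul_eq_zero.1 h1).resolve_left (by positivity)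
    · rw [hm, mul_zero] at h2
      have h3 := (mul_eq_zero.1 h2.symm).resolve_left (by positivity)
      rw [h3, mul_zero] at h1
      exact (mul_eq_zero.1 h1).resolve_left (by positivity)
  induction m using Nat.strong_induction_on with
  | _ m ih =>
    rcases m with _ | _ | m
    · have : gegenbauer lam (0 + 1) = monomial 1 (2 * lam) := by
        simp [gegenbauer, ← C_mul_X_pow_eq_monomial]
      rw [this, betaInt_monomial]
      simp [betaMoment]
    · exact hstep 0 (Or.inl rfl)
    · exact hstep (m + 1) (Or.inr (ih m (by omega)))

/-- The recurrence trades a factor `X` on `C_{m+1}` for `C_{m+2}` and `C_m`; both degrees still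
exceed the remaining power of `X`. -/
theorem betaInt_gegenbauer_mul_pow {lam : ℝ} (hl : 0 < lam) (j m : ℕ) (hj : j < m) :
    betaInt (lam + 1 / 2) (X ^ j * gegenbauer lam m) = 0 := by
  induction j generalizing m with
  | zero =>
    obtain ⟨m, rfl⟩ := Nat.exists_eq_succ_of_ne_zero hj.ne'
    simpa using betaInt_gegenbauer_eq_zero hl m
  | succ j ih =>
    obtain ⟨m, rfl⟩ := Nat.exists_eq_succ_of_ne_zero (Nat.ne_zero_of_lt hj)
    have hr := congrArg (fun p => betaInt (lam + 1 / 2) (X ^ j * p)) (gegenbauer_rec lam m)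
    have e1 : X ^ j * (C ((m : ℝ) + 2) * gegenbauer lam (m + 2)) =
      C ((m : ℝ) + 2) * (X ^ j * gegenbauer lam (m + 2)) := by ring
    have e2 : X ^ j * (C (2 * ((m : ℝ) + 1 + lam)) * X * gegenbauer lam (m + 1) -
        C ((m : ℝ) + 2 * lam) * gegenbauer lam m) =
      C (2 * ((m : ℝ) + 1 + lam)) * (X ^ (j + 1) * gegenbauer lam (m + 1)) -
        C ((m : ℝ) + 2 * lam) * (X ^ j * gegenbauer lam m) := by ring
    simp only [e1, e2, map_sub, betaInt_C_mul] at hr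
    rw [ih (m + 2) (by omega), ih m (by omega)] at hr
    have h3 : (2 * ((m : ℝ) + 1 + lam)) ≠ 0 := by positivity
    apply mul_left_cancel₀ h3
    rw [Nat.succ_eq_add_one]
    linear_combination -hr

theorem betaInt_mul_gegenbauer {lam : ℝ} (hl : 0 < lam) (m : ℕ) (p : ℝ[X])
    (hp : p.natDegree < m) : betaInt (lam + 1 / 2) (p * gegenbauer lam m) = 0 := by
  rw [p.as_sum_range_C_mul_X_pow, Finset.sum_mul, map_sum]
  refine Finset.sum_eq_zero fun i hi => ?_
  rw [mul_assoc, betaInt_C_mul,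
    betaInt_gegenbauer_mul_pow hl i m (by have := Finset.mem_range.1 hi; omega), mul_zero]

theorem natDegree_gegenbauer_le (lam : ℝ) (m : ℕ) : (gegenbauer lam m).natDegree ≤ m := by
  induction m using Nat.strong_induction_on with
  | _ m ih =>
    rcases m with _ | _ | m
    · simp [gegenbauer]
    · rw [gegenbauer]
      exact (natDegree_C_mul_le _ _).trans natDegree_X_le
    · rw [gegenbauer]
      refine (natDegree_C_mul_le _ _).trans ((natDegree_sub_le _ _).trans (max_le ?_ ?_))
      · refine natDegree_mul_le.trans ?_
        have h1 := ih (m + 1) (by omega)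
        have h2 := (natDegree_C_mul_le (2 * ((m : ℝ) + 1 + lam)) X).trans natDegree_X_le
        omega
      · exact (natDegree_C_mul_le _ _).trans ((ih m (by omega)).trans (by omega))

theorem betaInt_gegenbauer_mul_gegenbauer {lam : ℝ} (hl : 0 < lam) {m m' : ℕ} (h : m ≠ m') :
    betaInt (lam + 1 / 2) (gegenbauer lam m * gegenbauer lam m') = 0 := by
  rcases lt_or_gt_of_ne h with h | h
  · exact betaInt_mul_gegenbauer hl _ _ ((natDegree_gegenbauer_le lam m).trans_lt h)
  · rw [mul_comm]
    exact betaInt_mul_gegenbauer hl _ _ ((natDegree_gegenbauer_le lam m').trans_lt h)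

/-- The integral of `X C_m C_{m+1}` is evaluated twice: by the recurrence for `C_{m+1}` paired with
`C_{m+1}`, and by the recurrence for `C_{m+2}` paired with `C_m`. Orthogonality removes the third
term each time. -/
theorem betaInt_gegenbauer_sq_succ {lam : ℝ} (hl : 0 < lam) (m : ℕ) :
    ((m : ℝ) + 1) * (m + 1 + lam) *
        betaInt (lam + 1 / 2) (gegenbauer lam (m + 1) * gegenbauer lam (m + 1)) =
      ((m : ℝ) + lam) * (m + 2 * lam) *
        betaInt (lam + 1 / 2) (gegenbauer lam m * gegenbauer lam m) := by
  set B := betaInt (lam + 1 / 2) with hB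
  have h1 : ((m : ℝ) + 1) * B (gegenbauer lam (m + 1) * gegenbauer lam (m + 1)) =
      2 * (m + lam) * B (X * gegenbauer lam m * gegenbauer lam (m + 1)) := by
    rcases m with _ | m
    · have hr := congrArg (fun p => B (p * gegenbauer lam 1)) (gegenbauer_rec_one lam)
      simp only [mul_assoc, hB, betaInt_C_mul] at hr ⊢
      simp only [Nat.cast_zero, zero_add]
      linear_combination hr
    · have hr := congrArg (fun p => B (p * gegenbauer lam (m + 2))) (gegenbauer_rec lam m)
      simp only [sub_mul, mul_assoc, map_sub, hB, betaInt_C_mul] at hr ⊢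
      rw [betaInt_gegenbauer_mul_gegenbauer hl (m := m) (m' := m + 2) (by omega)] at hr
      push_cast
      linear_combination hr
  have h2 : ((m : ℝ) + 2 * lam) * B (gegenbauer lam m * gegenbauer lam m) =
      2 * (m + 1 + lam) * B (X * gegenbauer lam m * gegenbauer lam (m + 1)) := by
    have hr := congrArg (fun p => B (p * gegenbauer lam m)) (gegenbauer_rec lam m)
    simp only [sub_mul, mul_assoc, map_sub, hB, betaInt_C_mul] at hr ⊢
    rw [betaInt_gegenbauer_mul_gegenbauer hl (m := m + 2) (m' := m) (by omega),
      mul_comm (gegenbauer lam (m + 1))] at hr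
    linear_combination hr
  linear_combination (m + 1 + lam) * h1 - (m + lam) * h2

/-- The classical norm of `C_m^λ`, with denominators cleared. The case `m = 0` is Legendre's
duplication formula for `Γ`; the rest follows from the ratio of consecutive norms. -/
theorem betaInt_gegenbauer_sq {lam : ℝ} (hl : 0 < lam) (m : ℕ) :
    betaInt (lam + 1 / 2) (gegenbauer lam m * gegenbauer lam m) *
        (m.factorial * (m + lam) * Real.Gamma lam ^ 2) =
      Real.pi * (2 : ℝ) ^ (1 - 2 * lam) * Real.Gamma (m + 2 * lam) := by
  induction m with
  | zero =>
    have h1 : gegenbauer lam 0 * gegenbauer lam 0 = monomial 0 1 := by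
      simp [gegenbauer]
    rw [h1, betaInt_monomial, betaMoment, if_pos (by simp)]
    have h2 := Real.Gamma_mul_Gamma_add_half lam
    have h3 := Real.Gamma_add_one hl.ne'
    have h4 : lam + 1 / 2 + (((0 : ℕ) : ℝ) + 1) / 2 = lam + 1 := by push_cast; ring
    have h5 : (((0 : ℕ) : ℝ) + 1) / 2 = 1 / 2 := by norm_num
    have h6 := (Real.Gamma_pos_of_pos hl).ne'
    rw [h4, h5, Real.Gamma_one_half_eq, h3]
    have h7 : Real.pi = Real.sqrt Real.pi * Real.sqrt Real.pi :=
      (Real.mul_self_sqrt Real.pi_pos.le).symm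
    simp only [Nat.factorial_zero, Nat.cast_one, Nat.cast_zero, zero_add, one_mul]
    have h8 (G : ℝ) : G / (lam * Real.Gamma lam) * (lam * Real.Gamma lam ^ 2) =
        G * Real.Gamma lam := by field_simp
    rw [h8]
    nth_rw 2 [h7]
    linear_combination Real.sqrt Real.pi * h2
  | succ m ih =>
    have h := betaInt_gegenbauer_sq_succ hl m
    have hG : Real.Gamma (((m + 1 : ℕ) : ℝ) + 2 * lam) =
        (m + 2 * lam) * Real.Gamma (m + 2 * lam) := by
      rw [← Real.Gamma_add_one (by positivity)]
      congr 1
      push_cast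
      ring
    rw [hG, Nat.factorial_succ]
    push_cast
    linear_combination (m.factorial * Real.Gamma lam ^ 2) * h + (m + 2 * lam) * ih

end GegenbauerIntegrals

open MeasureTheory

/-! ### Homogeneous polynomial functions and integrals over the sphere -/

/-- Homogeneous complex polynomial functions of degree `n` on `ℝ^d`. -/
inductive IsHom (d : ℕ) : ℕ → (EuclideanSpace ℝ (Fin d) → ℂ) → Prop
  | const (c : ℂ) : IsHom d 0 fun _ => c
  | coord (i : Fin d) : IsHom d 1 fun x => (x i : ℂ)
  | add {n : ℕ} {f g : EuclideanSpace ℝ (Fin d) → ℂ} :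
      IsHom d n f → IsHom d n g → IsHom d n fun x => f x + g x
  | mul {n m : ℕ} {f g : EuclideanSpace ℝ (Fin d) → ℂ} :
      IsHom d n f → IsHom d m g → IsHom d (n + m) fun x => f x * g x

namespace IsHom

variable {d n m : ℕ} {f g : EuclideanSpace ℝ (Fin d) → ℂ}

theorem congr_degree (hf : IsHom d n f) (h : n = m) : IsHom d m f := h ▸ hf

theorem const_mul (c : ℂ) (hf : IsHom d n f) : IsHom d n fun x => c * f x :=
  ((IsHom.const c).mul hf).congr_degree (zero_add n)

theorem zero (hf : IsHom d n f) : IsHom d n fun _ => 0 := by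
  simpa using hf.const_mul 0

theorem sub (hf : IsHom d n f) (hg : IsHom d n g) : IsHom d n fun x => f x - g x := by
  simpa [sub_eq_add_neg] using hf.add (hg.const_mul (-1))

theorem pow (hf : IsHom d n f) (a : ℕ) : IsHom d (n * a) fun x => f x ^ a := by
  induction a with
  | zero => simpa using IsHom.const (d := d) 1
  | succ a ih => simpa [pow_succ, mul_add] using ih.mul hf

/-- No constructor yields zero in degree `n` outright; it arises as `0 · f` from some homogeneous
`f` of degree `n`, here a power of a coordinate. In dimension zero no such `f` exists for `n > 0`.
-/
theorem zero_fun [NeZero d] (n : ℕ) : IsHom d n fun _ => 0 :=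
  (((IsHom.coord (0 : Fin d)).pow n).congr_degree (one_mul n)).zero

theorem sum [NeZero d] {ι : Type*} (s : Finset ι) (F : ι → EuclideanSpace ℝ (Fin d) → ℂ)
    (h : ∀ i ∈ s, IsHom d n (F i)) : IsHom d n fun x => ∑ i ∈ s, F i x := by
  classical
  induction s using Finset.induction_on with
  | empty => simpa using zero_fun (d := d) n
  | insert i s hi ih =>
    simp only [Finset.sum_insert hi]
    exact (h i (Finset.mem_insert_self i s)).add
      (ih fun j hj => h j (Finset.mem_insert_of_mem hj))

theorem star (hf : IsHom d n f) : IsHom d n fun x => conj (f x) := by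
  induction hf with
  | const c => exact IsHom.const _
  | coord i => simpa using IsHom.coord i
  | add _ _ h1 h2 => simpa using h1.add h2
  | mul _ _ h1 h2 => simpa using h1.mul h2

@[fun_prop]
theorem continuous (hf : IsHom d n f) : Continuous f := by
  induction hf with
  | const c => exact continuous_const
  | coord i => fun_prop
  | add _ _ h1 h2 => exact h1.add h2
  | mul _ _ h1 h2 => exact h1.mul h2

theorem map_smul (hf : IsHom d n f) (r : ℝ) (x : EuclideanSpace ℝ (Fin d)) :
    f (r • x) = (r : ℂ) ^ n * f x := by
  induction hf with
  | const c => simp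
  | coord i => simp
  | add _ _ h1 h2 => simp only [h1, h2, mul_add]
  | mul _ _ h1 h2 => simp only [h1, h2, pow_add]; ring

/-- Homogeneous polynomials stay so under a linear change of variables. -/
theorem comp_mulVec {e : ℕ} [NeZero e] (hf : IsHom d n f) (A : Matrix (Fin d) (Fin e) ℝ) :
    IsHom e n fun x => f (WithLp.toLp 2 (A.mulVec x.ofLp)) := by
  induction hf with
  | const c => exact IsHom.const c
  | coord i =>
    simp only [Matrix.mulVec, dotProduct, Complex.ofReal_sum, Complex.ofReal_mul]
    exact IsHom.sum _ _ fun j _ => (IsHom.coord j).const_mul _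
  | add _ _ h1 h2 => exact h1.add h2
  | mul _ _ h1 h2 => exact h1.mul h2

end IsHom

/-- The first `d` coordinates of a point of `ℝ^{d+1}`. -/
def initCoords {d : ℕ} (x : EuclideanSpace ℝ (Fin (d + 1))) : EuclideanSpace ℝ (Fin d) :=
  WithLp.toLp 2 fun i => x i.castSucc

theorem norm_sq_initCoords {d : ℕ} (x : EuclideanSpace ℝ (Fin (d + 1))) :
    ‖x‖ ^ 2 = ‖initCoords x‖ ^ 2 + x (Fin.last d) ^ 2 := by
  rw [EuclideanSpace.norm_sq_eq, EuclideanSpace.norm_sq_eq, Fin.sum_univ_castSucc]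
  simp [initCoords]

theorem IsHom.comp_init {d n : ℕ} {f : EuclideanSpace ℝ (Fin d) → ℂ} (hf : IsHom d n f) :
    IsHom (d + 1) n fun x => f (initCoords x) := by
  induction hf with
  | const c => exact IsHom.const c
  | coord i => exact IsHom.coord i.castSucc
  | add _ _ h1 h2 => exact h1.add h2
  | mul _ _ h1 h2 => exact h1.mul h2

/-- The total surface area of `𝕊^{d-1}`. -/
def sphArea (d : ℕ) : ℝ :=
  (volume : Measure (EuclideanSpace ℝ (Fin d))).toSphere.real Set.univ

theorem sphArea_pos (d : ℕ) [NeZero d] : 0 < sphArea d := by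
  rw [sphArea, Measure.real, ENNReal.toReal_pos_iff]
  refine ⟨?_, measure_lt_top _ _⟩
  rw [pos_iff_ne_zero, Ne, Measure.measure_univ_eq_zero]
  exact Measure.toSphere_ne_zero _

instance (d : ℕ) [NeZero d] : IsProbabilityMeasure (sphMeasure d) := by
  refine ⟨?_⟩
  rw [sphMeasure, Measure.smul_apply, smul_eq_mul]
  refine ENNReal.inv_mul_cancel ?_ (measure_ne_top _ _)
  rw [Ne, Measure.measure_univ_eq_zero]
  exact Measure.toSphere_ne_zero _

theorem integral_toSphere (d : ℕ) [NeZero d] (f : Sph d → ℂ) :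
    ∫ x, f x ∂(volume : Measure (EuclideanSpace ℝ (Fin d))).toSphere =
      sphArea d * ∫ x, f x ∂sphMeasure d := by
  rw [sphMeasure, integral_smul_measure, ENNReal.toReal_inv]
  change _ = _ * ((sphArea d)⁻¹ • _)
  rw [Complex.real_smul, Complex.ofReal_inv, mul_inv_cancel_left₀]
  exact_mod_cast (sphArea_pos d).ne'

theorem integral_Ioi_pow_mul_exp (k : ℕ) :
    ∫ r in Set.Ioi (0 : ℝ), r ^ k * Real.exp (-r ^ 2) = Real.Gamma (((k : ℝ) + 1) / 2) / 2 := by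
  have h := integral_rpow_mul_exp_neg_rpow (p := 2) (q := k) (by norm_num)
    (by linarith [Nat.cast_nonneg (α := ℝ) k])
  simp only [Real.rpow_natCast, Real.rpow_two] at h
  rw [h]
  ring

/-- The Gaussian integral of a homogeneous polynomial in polar coordinates. -/
theorem IsHom.integral_gauss {d n : ℕ} [NeZero d] {f : EuclideanSpace ℝ (Fin d) → ℂ}
    (hf : IsHom d n f) :
    ∫ x, f x * (Real.exp (-‖x‖ ^ 2) : ℂ) =
      (sphArea d * (Real.Gamma (((d : ℝ) + n) / 2) / 2) : ℝ) *
        ∫ x : Sph d, f x.1 ∂sphMeasure d := by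
  have hd : Module.finrank ℝ (EuclideanSpace ℝ (Fin d)) - 1 = d - 1 := by simp
  have hd1 : 1 ≤ d := NeZero.one_le
  calc
    ∫ x, f x * (Real.exp (-‖x‖ ^ 2) : ℂ)
      = ∫ x : ({0}ᶜ : Set (EuclideanSpace ℝ (Fin d))),
          f x.1 * (Real.exp (-‖x.1‖ ^ 2) : ℂ) ∂(volume.comap Subtype.val) := by
      rw [integral_subtype_comap (measurableSet_singleton _).compl
        fun x => f x * (Real.exp (-‖x‖ ^ 2) : ℂ), restrict_compl_singleton]
    _ = ∫ p : Sph d × Set.Ioi (0 : ℝ), f p.1.1 * ((p.2.1 ^ n * Real.exp (-p.2.1 ^ 2) : ℝ) : ℂ)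
          ∂((volume : Measure (EuclideanSpace ℝ (Fin d))).toSphere.prod
            (.volumeIoiPow (d - 1))) := by
      rw [← hd, ← (volume : Measure (EuclideanSpace ℝ
        (Fin d))).measurePreserving_homeomorphUnitSphereProd.integral_comp
        (Homeomorph.measurableEmbedding _)]
      refine integral_congr_ae (Filter.Eventually.of_forall fun x => ?_)
      have hx : ‖x.1‖ ≠ 0 := norm_ne_zero_iff.2 x.2
      have h1 : x.1 = ‖x.1‖ • (‖x.1‖⁻¹ • x.1) := by
        rw [smul_smul, mul_inv_cancel₀ hx, one_smul]
      simp only [homeomorphUnitSphereProd_apply_snd_coe, homeomorphUnitSphereProd_apply_fst_coe]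
      -- Homogeneity pulls the radius out of `f` as `‖x‖^n`; the last rewrite restores `x` in the
      -- Gaussian factor.
      conv_lhs => rw [h1, hf.map_smul, ← h1]
      push_cast
      ring
    _ = (∫ x : Sph d, f x.1 ∂(volume : Measure (EuclideanSpace ℝ (Fin d))).toSphere) *
          ∫ r : Set.Ioi (0 : ℝ), ((r.1 ^ n * Real.exp (-r.1 ^ 2) : ℝ) : ℂ)
            ∂(Measure.volumeIoiPow (d - 1)) :=
      integral_prod_mul (fun x : Sph d => f x)
        (fun r : Set.Ioi (0 : ℝ) => ((r.1 ^ n * Real.exp (-r.1 ^ 2) : ℝ) : ℂ))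
    _ = _ := by
      rw [integral_toSphere, integral_complex_ofReal]
      have : ∫ r : Set.Ioi (0 : ℝ), (r.1 ^ n * Real.exp (-r.1 ^ 2) : ℝ)
            ∂(Measure.volumeIoiPow (d - 1)) = Real.Gamma (((d : ℝ) + n) / 2) / 2 := by
        simp only [Measure.volumeIoiPow, ENNReal.ofReal]
        rw [integral_withDensity_eq_integral_smul, integral_subtype_comap measurableSet_Ioi
          fun a : ℝ => Real.toNNReal (a ^ (d - 1)) • (a ^ n * Real.exp (-a ^ 2)),
          setIntegral_congr_fun (g := fun a => a ^ (d - 1 + n) * Real.exp (-a ^ 2))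
            measurableSet_Ioi fun x hx => ?_]
        · rw [integral_Ioi_pow_mul_exp]
          congr 3
          push_cast [Nat.cast_sub hd1]
          ring
        · simp only
          rw [NNReal.smul_def, Real.coe_toNNReal _ (pow_nonneg hx.out.le _), pow_add, smul_eq_mul,
            mul_assoc]
        · exact (measurable_subtype_coe.pow_const _).real_toNNReal
      rw [this]
      push_cast
      ring

/-- The Gaussian moments `∫ t^a e^{-t²} dt`. -/
theorem integral_pow_mul_exp (a : ℕ) :
    ∫ t : ℝ, t ^ a * Real.exp (-t ^ 2) =
      if Even a then Real.Gamma (((a : ℝ) + 1) / 2) else 0 := by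
  split_ifs with h
  · have h1 := integral_comp_abs (f := fun t : ℝ => t ^ a * Real.exp (-t ^ 2))
    simp only [h.pow_abs, sq_abs] at h1
    rw [h1, integral_Ioi_pow_mul_exp]
    ring
  · have h1 := integral_neg_eq_self (fun t : ℝ => t ^ a * Real.exp (-t ^ 2)) volume
    simp only [(Nat.not_even_iff_odd.1 h).neg_pow, neg_mul, integral_neg, even_two.neg_pow] at h1
    linarith

/-! ### Slicing sphere integrals along the last coordinate -/

theorem integral_gauss_init {d : ℕ} (f : EuclideanSpace ℝ (Fin d) → ℂ) (a : ℕ) :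
    ∫ x : EuclideanSpace ℝ (Fin (d + 1)),
        (x (Fin.last d) : ℂ) ^ a * f (initCoords x) * (Real.exp (-‖x‖ ^ 2) : ℂ) =
      (if Even a then Real.Gamma (((a : ℝ) + 1) / 2) else 0 : ℝ) *
        ∫ x, f x * (Real.exp (-‖x‖ ^ 2) : ℂ) := by
  rw [← integral_pow_mul_exp, ← integral_complex_ofReal,
    ← (PiLp.volume_preserving_toLp (Fin d)).integral_comp
      (MeasurableEquiv.toLp 2 _).measurableEmbedding,
    ← (PiLp.volume_preserving_toLp (Fin (d + 1))).integral_comp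
      (MeasurableEquiv.toLp 2 _).measurableEmbedding, ← integral_prod_mul,
    ← Measure.volume_eq_prod,
    ← (volume_preserving_piFinSuccAbove (fun _ : Fin (d + 1) => ℝ) (Fin.last d)).integral_comp
      (MeasurableEquiv.piFinSuccAbove _ _).measurableEmbedding]
  refine integral_congr_ae (Filter.Eventually.of_forall fun x => ?_)
  have h := norm_sq_initCoords (WithLp.toLp 2 x)
  have h1 : initCoords (WithLp.toLp 2 x) =
      WithLp.toLp 2 ((MeasurableEquiv.piFinSuccAbove (fun _ : Fin (d + 1) => ℝ)
        (Fin.last d) x).2) := by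
    ext i
    simp [initCoords, MeasurableEquiv.piFinSuccAbove, Fin.init]
  have h2 : (MeasurableEquiv.piFinSuccAbove (fun _ : Fin (d + 1) => ℝ) (Fin.last d) x).1 =
      x (Fin.last d) := by
    simp [MeasurableEquiv.piFinSuccAbove]
  simp only
  rw [← h1, h2, h, neg_add, Real.exp_add]
  push_cast
  ring

/-- The Gaussian integral of `1` over `ℝ^{d+1}` equals `√π` times the one over `ℝ^d`; polar
coordinates turn both into sphere areas. -/
theorem sphArea_succ (d : ℕ) [NeZero d] :
    sphArea (d + 1) * Real.Gamma (((d : ℝ) + 1) / 2) =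
      Real.sqrt Real.pi * (sphArea d * Real.Gamma ((d : ℝ) / 2)) := by
  have h1 := (IsHom.const (d := d + 1) 1).integral_gauss
  have h2 := (IsHom.const (d := d) 1).integral_gauss
  have h3 := integral_gauss_init (d := d) (fun _ => 1) 0
  simp only [pow_zero, one_mul, mul_one] at h1 h2 h3
  rw [h1, h2] at h3
  have h4 : (((0 : ℕ) : ℝ) + 1) / 2 = 1 / 2 := by norm_num
  rw [h4] at h3
  simp only [Even.zero, if_true, Real.Gamma_one_half_eq, integral_const, probReal_univ, one_smul,
    mul_one, Nat.cast_zero, add_zero, Nat.cast_add, Nat.cast_one] at h3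
  rw [← Complex.ofReal_mul] at h3
  have h5 := Complex.ofReal_injective h3
  linarith

/-- The ratio `|𝕊^{d-1}| / |𝕊^d|` of surface areas. -/
def sliceConst (d : ℕ) : ℝ :=
  Real.Gamma (((d : ℝ) + 1) / 2) / (Real.sqrt Real.pi * Real.Gamma ((d : ℝ) / 2))

/-- The Gaussian integral of `x_last^a f(initCoords x)` is computed in polar coordinates of
`ℝ^{d+1}`, and also by splitting off the last coordinate and then using polar coordinates of `ℝ^d`.
The quotient of the Gamma factors is a Beta moment with `μ = (d + k)/2`, so the degree of `f` enters
the weight. -/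
theorem IsHom.integral_sphere_pow {d k : ℕ} [NeZero d] {f : EuclideanSpace ℝ (Fin d) → ℂ}
    (hf : IsHom d k f) (a : ℕ) :
    ∫ x : Sph (d + 1), (x.1 (Fin.last d) : ℂ) ^ a * f (initCoords x.1) ∂sphMeasure (d + 1) =
      (sliceConst d * betaMoment (((d : ℝ) + k) / 2) a : ℝ) * ∫ x : Sph d, f x ∂sphMeasure d := by
  have hd : (0 : ℝ) < d := by exact_mod_cast NeZero.pos d
  have h1 := (((IsHom.coord (Fin.last d)).pow a).mul hf.comp_init).integral_gauss
  rw [integral_gauss_init, hf.integral_gauss] at h1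
  have hA := sphArea_succ d
  have hG : Real.Gamma (((d + 1 : ℕ) + (1 * a + k : ℕ) : ℝ) / 2) ≠ 0 :=
    (Real.Gamma_pos_of_pos (by positivity)).ne'
  have hG1 : Real.Gamma ((d : ℝ) / 2) ≠ 0 := (Real.Gamma_pos_of_pos (by positivity)).ne'
  have hG2 : Real.Gamma (((d : ℝ) + 1) / 2) ≠ 0 := (Real.Gamma_pos_of_pos (by positivity)).ne'
  have hπ : Real.sqrt Real.pi ≠ 0 := (Real.sqrt_pos.2 Real.pi_pos).ne'
  have hS := (sphArea_pos d).ne'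
  have hS' := (sphArea_pos (d + 1)).ne'
  have harg : ((d : ℝ) + k) / 2 + ((a : ℝ) + 1) / 2 = ((d + 1 : ℕ) + (1 * a + k : ℕ) : ℝ) / 2 := by
    push_cast; ring
  have hc : sphArea (d + 1) * (Real.Gamma (((d + 1 : ℕ) + (1 * a + k : ℕ) : ℝ) / 2) / 2) *
      (sliceConst d * betaMoment (((d : ℝ) + k) / 2) a) =
      (if Even a then Real.Gamma (((a : ℝ) + 1) / 2) else 0) *
        (sphArea d * (Real.Gamma (((d : ℝ) + k) / 2) / 2)) := by
    unfold betaMoment sliceConst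
    rw [harg]
    generalize Real.Gamma (((d + 1 : ℕ) + (1 * a + k : ℕ) : ℝ) / 2) = G at hG ⊢
    generalize Real.Gamma (((d : ℝ) + 1) / 2) = G2 at hG2 hA ⊢
    generalize Real.Gamma ((d : ℝ) / 2) = G1 at hG1 hA ⊢
    generalize Real.Gamma (((a : ℝ) + 1) / 2) = Ga
    generalize Real.Gamma (((d : ℝ) + k) / 2) = Gk
    split_ifs
    · field_simp
      linear_combination Ga * Gk * hA
    · simp
  have hne : ((sphArea (d + 1) * (Real.Gamma (((d + 1 : ℕ) + (1 * a + k : ℕ) : ℝ) / 2) / 2) : ℝ) : ℂ)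
      ≠ 0 := by
    exact_mod_cast mul_ne_zero hS' (div_ne_zero hG two_ne_zero)
  apply mul_left_cancel₀ hne
  rw [← mul_assoc (Complex.ofReal _), ← Complex.ofReal_mul, hc,
    Complex.ofReal_mul _ (sphArea d * _), mul_assoc]
  exact h1.symm

theorem integrable_sphere {d : ℕ} [NeZero d] {f : Sph d → ℂ} (hf : Continuous f) :
    Integrable f (sphMeasure d) :=
  hf.integrable_of_hasCompactSupport (HasCompactSupport.of_compactSpace f)

/-- Integration over `𝕊^d` in terms of the last coordinate and of the other ones. -/
theorem IsHom.integral_sphere_slice {d k : ℕ} [NeZero d] {f : EuclideanSpace ℝ (Fin d) → ℂ}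
    (hf : IsHom d k f) (p : Polynomial ℝ) :
    ∫ x : Sph (d + 1), ((p.eval (x.1 (Fin.last d)) : ℝ) : ℂ) * f (initCoords x.1)
        ∂sphMeasure (d + 1) =
      (sliceConst d * betaInt (((d : ℝ) + k) / 2) p : ℝ) * ∫ x : Sph d, f x ∂sphMeasure d := by
  have hfc (q : Polynomial ℝ) : Continuous fun x : Sph (d + 1) =>
      ((q.eval (x.1 (Fin.last d)) : ℝ) : ℂ) * f (initCoords x.1) :=
    (Complex.continuous_ofReal.comp (q.continuous.comp (by fun_prop))).mul
      (hf.comp_init.continuous.comp continuous_subtype_val)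
  induction p using Polynomial.induction_on' with
  | add p q hp hq =>
    simp only [Polynomial.eval_add, Complex.ofReal_add, add_mul, map_add, mul_add]
    rw [integral_add, hp, hq]
    · exact integrable_sphere (hfc p)
    · exact integrable_sphere (hfc q)
  | monomial a c =>
    simp only [Polynomial.eval_monomial, Complex.ofReal_mul, Complex.ofReal_pow, mul_assoc,
      betaInt_monomial]
    rw [integral_const_mul, hf.integral_sphere_pow]
    push_cast
    ring

/-! ### Invariance and parity of the sphere integral -/

theorem gaussFactor_ne_zero (d n : ℕ) [NeZero d] :
    ((sphArea d * (Real.Gamma (((d : ℝ) + n) / 2) / 2) : ℝ) : ℂ) ≠ 0 := by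
  have hd : (0 : ℝ) < d := by exact_mod_cast NeZero.pos d
  exact_mod_cast mul_ne_zero (sphArea_pos d).ne'
    (div_ne_zero (Real.Gamma_pos_of_pos
      (div_pos (add_pos_of_pos_of_nonneg hd (Nat.cast_nonneg n)) two_pos)).ne' two_ne_zero)

/-- The linear isometry of `ℝ^d` given by an element of `SO(d)`. -/
def rotIsometry {d : ℕ} (g : SO d) : EuclideanSpace ℝ (Fin d) ≃ₗᵢ[ℝ] EuclideanSpace ℝ (Fin d) :=
  LinearIsometry.toLinearIsometryEquiv
    { toLinearMap := Matrix.toEuclideanLin (g : Matrix (Fin d) (Fin d) ℝ)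
      norm_map' := norm_mulVec_SO g } rfl

theorem rotIsometry_apply {d : ℕ} (g : SO d) (x : EuclideanSpace ℝ (Fin d)) :
    rotIsometry g x = WithLp.toLp 2 ((g : Matrix (Fin d) (Fin d) ℝ).mulVec x.ofLp) := rfl

theorem rotIsometry_rotIsometry_inv {d : ℕ} (g : SO d) (x : EuclideanSpace ℝ (Fin d)) :
    rotIsometry g (rotIsometry g⁻¹ x) = x := by
  rw [rotIsometry_apply, rotIsometry_apply]
  have : (g : Matrix (Fin d) (Fin d) ℝ) * ((g⁻¹ : SO d) : Matrix (Fin d) (Fin d) ℝ) = 1 := by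
    rw [← Submonoid.coe_mul, mul_inv_cancel, Submonoid.coe_one]
  simp [Matrix.mulVec_mulVec, this]

theorem IsHom.comp_rot {d n : ℕ} [NeZero d] {f : EuclideanSpace ℝ (Fin d) → ℂ}
    (hf : IsHom d n f) (g : SO d) : IsHom d n fun x => f (rotIsometry g x) :=
  hf.comp_mulVec _

theorem rot_coe {d : ℕ} (g : SO d) (x : Sph d) : (rot g x).1 = rotIsometry g x.1 := rfl

/-- Lebesgue measure and the Gaussian are both invariant under the rotation, and
`IsHom.integral_gauss` carries this over to the sphere since the factor relating the two integrals
is nonzero. -/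
theorem IsHom.integral_rot {d n : ℕ} [NeZero d] {f : EuclideanSpace ℝ (Fin d) → ℂ}
    (hf : IsHom d n f) (g : SO d) :
    ∫ x : Sph d, f (rotIsometry g x.1) ∂sphMeasure d = ∫ x : Sph d, f x.1 ∂sphMeasure d := by
  apply mul_left_cancel₀ (gaussFactor_ne_zero d n)
  rw [← hf.integral_gauss, ← (hf.comp_rot g).integral_gauss,
    ← (rotIsometry g).measurePreserving.integral_comp
      (rotIsometry g).toHomeomorph.measurableEmbedding (fun x => f x * (Real.exp (-‖x‖ ^ 2) : ℂ))]
  simp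

theorem IsHom.integral_odd {d n : ℕ} [NeZero d] {f : EuclideanSpace ℝ (Fin d) → ℂ}
    (hf : IsHom d n f) (hn : Odd n) : ∫ x : Sph d, f x.1 ∂sphMeasure d = 0 := by
  have h1 := integral_neg_eq_self (fun x => f x * (Real.exp (-‖x‖ ^ 2) : ℂ)) volume
  have h2 (x : EuclideanSpace ℝ (Fin d)) : f (-x) = -f x := by
    have := hf.map_smul (-1) x
    simpa [hn.neg_pow] using this
  simp only [h2, norm_neg, neg_mul, integral_neg] at h1
  have h3 : ∫ x, f x * (Real.exp (-‖x‖ ^ 2) : ℂ) = 0 := self_eq_neg.1 h1.symm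
  rw [hf.integral_gauss] at h3
  exact (mul_eq_zero.1 h3).resolve_left (gaussFactor_ne_zero d n)

/-! ### Orthogonality to polynomials of lower degree -/

/-- `f` is orthogonal on the sphere to all homogeneous polynomials of degree less than `n`. -/
def IsOrthLower (d n : ℕ) (f : EuclideanSpace ℝ (Fin d) → ℂ) : Prop :=
  ∀ j < n, ∀ g, IsHom d j g → ∫ x : Sph d, g x.1 * conj (f x.1) ∂sphMeasure d = 0

/-- Expansion of a polynomial in powers of its last variable; in the product case the spans multiply
because the exponents add. It reduces orthogonality tests to products to which the slicing formula
applies. -/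
theorem IsHom.mem_span_slice {d n : ℕ} {f : EuclideanSpace ℝ (Fin (d + 1)) → ℂ}
    (hf : IsHom (d + 1) n f) :
    f ∈ Submodule.span ℂ {F | ∃ (b i : ℕ) (h : EuclideanSpace ℝ (Fin d) → ℂ), IsHom d i h ∧
      i + b = n ∧ F = fun x => (x (Fin.last d) : ℂ) ^ b * h (initCoords x)} := by
  induction hf with
  | const c => exact Submodule.subset_span ⟨0, 0, fun _ => c, IsHom.const c, rfl, by simp⟩
  | coord i =>
    refine Submodule.subset_span ?_
    induction i using Fin.lastCases with
    | last => exact ⟨1, 0, fun _ => 1, IsHom.const 1, rfl, by simp⟩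
    | cast i => exact ⟨0, 1, _, IsHom.coord i, rfl, by simp [initCoords]⟩
  | add _ _ h1 h2 => exact Submodule.add_mem _ h1 h2
  | mul _ _ h1 h2 =>
    have h3 := Submodule.mul_mem_mul h1 h2
    rw [Submodule.span_mul_span] at h3
    refine Submodule.span_mono ?_ h3
    rintro _ ⟨_, ⟨b, i, h, hh, hi, rfl⟩, _, ⟨b', i', h', hh', hi', rfl⟩, rfl⟩
    refine ⟨b + b', i + i', _, hh.mul hh', by omega, ?_⟩
    funext x
    simp only [Pi.mul_apply]
    ring

/-- Against `x_last^b h(initCoords x)` with `h` of degree `i`, slicing leaves a Gegenbauer integral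
times the integral of `h · conj f`. The latter vanishes if `i < m` by assumption on `f`, and if `i -
m` is odd by parity. If `i - m = 2s`, the weight is the Gegenbauer weight for `λ = (d-1)/2 + m`
times `(1 - X²)^s`; then `C_a^λ` is tested against a polynomial of degree at most `2s + b < a`. -/
theorem IsHom.orthLower_slice {d m : ℕ} [NeZero d] {f : EuclideanSpace ℝ (Fin d) → ℂ}
    (hf : IsHom d m f) (hd : 2 ≤ d) (ho : IsOrthLower d m f) (a : ℕ)
    {F : EuclideanSpace ℝ (Fin (d + 1)) → ℂ}
    (hF : ∀ x : Sph (d + 1), F x.1 =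
      (((gegenbauer (((d : ℝ) - 1) / 2 + m) a).eval (x.1 (Fin.last d)) : ℝ) : ℂ) *
        f (initCoords x.1)) : IsOrthLower (d + 1) (m + a) F := by
  intro j hj g hg
  have hd' : (2 : ℝ) ≤ d := by exact_mod_cast hd
  have hFc : Continuous fun x : Sph (d + 1) => F x.1 := by
    simp only [hF]
    exact (Complex.continuous_ofReal.comp ((Polynomial.continuous _).comp (by fun_prop))).mul
      (hf.comp_init.continuous.comp continuous_subtype_val)
  -- Continuity is carried through the span induction because additivity of the integral needs
  -- integrable summands.
  suffices h : Continuous g ∧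
      ∫ x : Sph (d + 1), g x.1 * conj (F x.1) ∂sphMeasure (d + 1) = 0 from h.2
  refine Submodule.span_induction ?_ ?_ ?_ ?_ hg.mem_span_slice
  · rintro _ ⟨b, i, h, hh, hi, rfl⟩
    refine ⟨?_, ?_⟩
    · exact (((IsHom.coord (Fin.last d)).pow b).mul hh.comp_init).continuous
    · have hint : ∀ x : Sph (d + 1), (x.1 (Fin.last d) : ℂ) ^ b * h (initCoords x.1) *
          conj (F x.1) =
          (((Polynomial.X ^ b * gegenbauer (((d : ℝ) - 1) / 2 + m) a).eval
            (x.1 (Fin.last d)) : ℝ) : ℂ) * (h (initCoords x.1) * conj (f (initCoords x.1))) := by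
        intro x
        rw [hF]
        simp only [map_mul, Complex.conj_ofReal, Polynomial.eval_mul, Polynomial.eval_pow,
          Polynomial.eval_X, Complex.ofReal_mul, Complex.ofReal_pow]
        ring
      simp only [hint]
      rw [(hh.mul hf.star).integral_sphere_slice]
      by_cases him : i < m
      · rw [ho i him h hh, mul_zero]
      · rcases Nat.even_or_odd (i - m) with ⟨s, hs⟩ | hodd
        · have harg : ((d : ℝ) + (i + m : ℕ)) / 2 = (((d : ℝ) - 1) / 2 + m + 1 / 2) + s := by
            have : (i : ℝ) = m + s + s := by
              exact_mod_cast (by omega : i = m + s + s)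
            push_cast
            rw [this]
            ring
          have hdeg : ((1 - Polynomial.X ^ 2 : Polynomial ℝ) ^ s * Polynomial.X ^ b).natDegree
              < a := by
            have h1 : (1 - Polynomial.X ^ 2 : Polynomial ℝ).natDegree ≤ 2 := by
              compute_degree
            have h2 : ((1 - Polynomial.X ^ 2 : Polynomial ℝ) ^ s).natDegree ≤ s * 2 :=
              Polynomial.natDegree_pow_le_of_le s h1
            have h3 := Polynomial.natDegree_mul_le
              (p := (1 - Polynomial.X ^ 2 : Polynomial ℝ) ^ s) (q := Polynomial.X ^ b)
            rw [Polynomial.natDegree_X_pow] at h3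
            omega
          have hl : 0 < ((d : ℝ) - 1) / 2 + m := by
            have := Nat.cast_nonneg (α := ℝ) m
            linarith
          rw [harg, betaInt_add_nat (by positivity), ← mul_assoc,
            betaInt_mul_gegenbauer hl a _ hdeg]
          simp
        · rw [(hh.mul hf.star).integral_odd, mul_zero]
          have : i + m = i - m + 2 * m := by omega
          rw [this]
          exact hodd.add_even (even_two_mul m)
  · exact ⟨continuous_const, by simp⟩
  · rintro u v - - ⟨hu, hu'⟩ ⟨hv, hv'⟩
    refine ⟨hu.add hv, ?_⟩
    simp only [Pi.add_apply, add_mul]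
    rw [integral_add, hu', hv', add_zero]
    · exact integrable_sphere ((hu.comp continuous_subtype_val).mul
        (Complex.continuous_conj.comp hFc))
    · exact integrable_sphere ((hv.comp continuous_subtype_val).mul
        (Complex.continuous_conj.comp hFc))
  · rintro c u - ⟨hu, hu'⟩
    refine ⟨continuous_const.mul hu, ?_⟩
    simp only [Pi.smul_apply, smul_eq_mul, mul_assoc]
    rw [integral_const_mul, hu', mul_zero]

/-- Orthogonality of (rotated) spherical harmonics of different degrees. -/
theorem IsHom.integral_rot_mul_conj_eq_zero {d m m' : ℕ} [NeZero d]
    {f f' : EuclideanSpace ℝ (Fin d) → ℂ} (hf : IsHom d m f) (hf' : IsHom d m' f')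
    (ho : IsOrthLower d m f) (ho' : IsOrthLower d m' f') (h : m ≠ m') (g : SO d) :
    ∫ x : Sph d, f (rotIsometry g x.1) * conj (f' x.1) ∂sphMeasure d = 0 := by
  rcases lt_or_gt_of_ne h with h | h
  · exact ho' m h _ (hf.comp_rot g)
  -- Here `m' < m`: rotating the variable by `g⁻¹` moves the rotation onto `f'`, and after
  -- conjugation `f'` becomes the test polynomial for `f`.
  · rw [← ((hf.comp_rot g).mul hf'.star).integral_rot g⁻¹]
    simp only [rotIsometry_rotIsometry_inv]
    have h1 := ho m' h _ (hf'.comp_rot g⁻¹)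
    have h2 := congrArg conj h1
    rw [← integral_conj, map_zero] at h2
    rw [← h2]
    refine integral_congr_ae (Filter.Eventually.of_forall fun x => ?_)
    simp only [map_mul, Complex.conj_conj]
    ring

/-! ### The circle -/

/-- The complex number `x₂ + i x₁`. -/
def circNum (x : EuclideanSpace ℝ (Fin 2)) : ℂ := (x 1 : ℂ) + (x 0 : ℂ) * Complex.I

/-- The polynomial that equals `e^{ikθ₁}` on the circle. -/
def circFun (k : ℤ) (x : EuclideanSpace ℝ (Fin 2)) : ℂ :=
  if 0 ≤ k then circNum x ^ k.natAbs else conj (circNum x) ^ k.natAbs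

theorem isHom_circNum : IsHom 2 1 circNum := by
  have := (IsHom.coord (1 : Fin 2)).add ((IsHom.coord (0 : Fin 2)).const_mul Complex.I)
  simpa only [mul_comm Complex.I] using! this

theorem isHom_circFun (k : ℤ) : IsHom 2 k.natAbs (circFun k) := by
  unfold circFun
  split_ifs
  · exact (isHom_circNum.pow _).congr_degree (one_mul _)
  · exact (isHom_circNum.star.pow _).congr_degree (one_mul _)

theorem norm_circNum (x : EuclideanSpace ℝ (Fin 2)) : ‖circNum x‖ = ‖x‖ := by
  rw [circNum, Complex.norm_add_mul_I, EuclideanSpace.norm_eq, Fin.sum_univ_two]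
  simp [add_comm]

theorem circNum_ne_zero (x : Sph 2) : circNum x.1 ≠ 0 := by
  rw [← norm_ne_zero_iff, norm_circNum]
  simp

theorem conj_circNum (x : Sph 2) : conj (circNum x.1) = (circNum x.1)⁻¹ := by
  rw [Complex.inv_def, Complex.normSq_eq_norm_sq, norm_circNum]
  simp

theorem circFun_eq_zpow (k : ℤ) (x : Sph 2) : circFun k x.1 = circNum x.1 ^ k := by
  unfold circFun
  split_ifs with h
  · conv_rhs => rw [← Int.natAbs_of_nonneg h]
    rw [zpow_natCast]
  · rw [conj_circNum, inv_pow, ← zpow_natCast, ← zpow_neg]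
    congr 1
    omega

theorem conj_circFun (k : ℤ) (x : Sph 2) : conj (circFun k x.1) = circFun (-k) x.1 := by
  rw [circFun_eq_zpow, circFun_eq_zpow, map_zpow₀, conj_circNum, inv_zpow, zpow_neg]

/-- The rotation of the plane by the angle `-γ`. -/
def circRot (γ : ℝ) : SO 2 :=
  ⟨!![Real.cos γ, Real.sin γ; -Real.sin γ, Real.cos γ], by
    rw [Matrix.mem_specialOrthogonalGroup_iff, Matrix.mem_orthogonalGroup_iff]
    have h := Real.sin_sq_add_cos_sq γ
    refine ⟨?_, ?_⟩
    · ext i j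
      fin_cases i <;> fin_cases j <;>
        simp [Matrix.mul_apply, Fin.sum_univ_two] <;> nlinarith
    · rw [Matrix.det_fin_two]
      simp
      nlinarith⟩

theorem circNum_rot (γ : ℝ) (x : EuclideanSpace ℝ (Fin 2)) :
    circNum (rotIsometry (circRot γ) x) = Complex.exp (γ * Complex.I) * circNum x := by
  rw [rotIsometry_apply, Complex.exp_mul_I, ← Complex.ofReal_cos, ← Complex.ofReal_sin]
  simp only [circNum, circRot]
  simp [Matrix.mulVec, dotProduct, Fin.sum_univ_two]
  linear_combination (-(x 0 : ℂ) * Complex.sin γ) * Complex.I_mul_I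

/-- The rotation with parameter `π/k` multiplies the integrand by `e^{iπ} = -1` and preserves the
integral. -/
theorem integral_circFun_eq_zero {k : ℤ} (hk : k ≠ 0) :
    ∫ x : Sph 2, circFun k x.1 ∂sphMeasure 2 = 0 := by
  have hk' : (k : ℂ) ≠ 0 := by exact_mod_cast hk
  have h := (isHom_circFun k).integral_rot (circRot (Real.pi / k))
  have h1 (x : Sph 2) : circFun k (rotIsometry (circRot (Real.pi / k)) x.1) = -circFun k x.1 := by
    rw [← rot_coe, circFun_eq_zpow, rot_coe, circNum_rot, mul_zpow, ← circFun_eq_zpow,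
      ← Complex.exp_int_mul]
    have : (k : ℂ) * (((Real.pi / k : ℝ) : ℂ) * Complex.I) = Real.pi * Complex.I := by
      push_cast
      field_simp
    rw [this, Complex.exp_pi_mul_I, neg_one_mul]
  simp only [h1, integral_neg] at h
  exact self_eq_neg.1 h.symm

theorem circFun_mul (k l : ℤ) (x : Sph 2) :
    circFun k x.1 * circFun l x.1 = circFun (k + l) x.1 := by
  rw [circFun_eq_zpow, circFun_eq_zpow, circFun_eq_zpow, zpow_add₀ (circNum_ne_zero x)]

theorem integral_circFun_mul_conj (k l : ℤ) :
    ∫ x : Sph 2, circFun k x.1 * conj (circFun l x.1) ∂sphMeasure 2 = if k = l then 1 else 0 := by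
  simp only [conj_circFun, circFun_mul]
  split_ifs with h
  · subst h
    simp [circFun]
  · exact integral_circFun_eq_zero (by omega)

/-- On the circle both coordinates are combinations of `z` and `z⁻¹`, where `z` is `circNum`, and
frequencies add under multiplication. -/
theorem IsHom.mem_span_circFun {n : ℕ} {f : EuclideanSpace ℝ (Fin 2) → ℂ} (hf : IsHom 2 n f) :
    (fun x : Sph 2 => f x.1) ∈ Submodule.span ℂ {F | ∃ k : ℤ, k.natAbs ≤ n ∧
      F = fun x : Sph 2 => circFun k x.1} := by
  induction hf with
  | const c =>
    have : (fun _ : Sph 2 => c) = c • fun x : Sph 2 => circFun 0 x.1 := by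
      funext x
      simp [circFun]
    rw [this]
    exact Submodule.smul_mem _ _ (Submodule.subset_span ⟨0, le_rfl, rfl⟩)
  | coord i =>
    have h1 : (fun x : Sph 2 => circFun 1 x.1) ∈ Submodule.span ℂ {F | ∃ k : ℤ, k.natAbs ≤ 1 ∧
      F = fun x : Sph 2 => circFun k x.1} := Submodule.subset_span ⟨1, le_rfl, rfl⟩
    have h2 : (fun x : Sph 2 => circFun (-1) x.1) ∈ Submodule.span ℂ {F | ∃ k : ℤ, k.natAbs ≤ 1 ∧
      F = fun x : Sph 2 => circFun k x.1} := Submodule.subset_span ⟨-1, le_rfl, rfl⟩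
    fin_cases i
    · have : (fun x : Sph 2 => ((x.1 0 : ℝ) : ℂ)) =
          (-Complex.I / 2) • (fun x : Sph 2 => circFun 1 x.1) +
          (Complex.I / 2) • fun x : Sph 2 => circFun (-1) x.1 := by
        funext x
        simp [circFun, circNum]
        linear_combination (x.1 0 : ℂ) * Complex.I_mul_I
      exact this ▸ Submodule.add_mem _ (Submodule.smul_mem _ _ h1) (Submodule.smul_mem _ _ h2)
    · have : (fun x : Sph 2 => ((x.1 1 : ℝ) : ℂ)) =
          (1 / 2 : ℂ) • (fun x : Sph 2 => circFun 1 x.1) +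
          (1 / 2 : ℂ) • fun x : Sph 2 => circFun (-1) x.1 := by
        funext x
        simp [circFun, circNum]
        ring
      exact this ▸ Submodule.add_mem _ (Submodule.smul_mem _ _ h1) (Submodule.smul_mem _ _ h2)
  | add _ _ h1 h2 => exact Submodule.add_mem _ h1 h2
  | mul _ _ h1 h2 =>
    have h3 := Submodule.mul_mem_mul h1 h2
    rw [Submodule.span_mul_span] at h3
    refine Submodule.span_mono ?_ h3
    rintro _ ⟨_, ⟨k, hk, rfl⟩, _, ⟨l, hl, rfl⟩, rfl⟩
    refine ⟨k + l, (Int.natAbs_add_le k l).trans (by omega), ?_⟩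
    funext x
    exact circFun_mul k l x

/-- A polynomial of degree `j < |k|` has only frequencies of absolute value at most `j` on the
circle. This starts the induction over dimensions. -/
theorem orthLower_circFun (k : ℤ) : IsOrthLower 2 k.natAbs (circFun k) := by
  intro j hj g hg
  have hc (l : ℤ) : Continuous fun x : Sph 2 => circFun l x.1 :=
    (isHom_circFun l).continuous.comp continuous_subtype_val
  suffices h : ∀ F : Sph 2 → ℂ, F ∈ Submodule.span ℂ {F | ∃ k : ℤ, k.natAbs ≤ j ∧
      F = fun x : Sph 2 => circFun k x.1} → Continuous F ∧
      ∫ x : Sph 2, F x * conj (circFun k x.1) ∂sphMeasure 2 = 0 from (h _ hg.mem_span_circFun).2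
  intro F hF
  refine Submodule.span_induction ?_ ?_ ?_ ?_ hF
  · rintro _ ⟨l, hl, rfl⟩
    refine ⟨hc l, ?_⟩
    rw [integral_circFun_mul_conj, if_neg (by rintro rfl; omega)]
  · exact ⟨continuous_const, by simp⟩
  · rintro u v - - ⟨hu, hu'⟩ ⟨hv, hv'⟩
    refine ⟨hu.add hv, ?_⟩
    simp only [Pi.add_apply, add_mul]
    rw [integral_add, hu', hv', add_zero]
    · exact integrable_sphere (hu.mul (Complex.continuous_conj.comp (hc k)))
    · exact integrable_sphere (hv.mul (Complex.continuous_conj.comp (hc k)))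
  · rintro c u - ⟨hu, hu'⟩
    refine ⟨continuous_const.mul hu, ?_⟩
    simp only [Pi.smul_apply, smul_eq_mul, mul_assoc]
    rw [integral_const_mul, hu', mul_zero]

/-! ### Spherical harmonics as homogeneous polynomials -/

/-- The homogenization `‖x‖^a C_a^λ(x_d / ‖x‖)` of a Gegenbauer polynomial. -/
def homGegenbauer {e : ℕ} (lam : ℝ) : ℕ → EuclideanSpace ℝ (Fin (e + 1)) → ℂ
  | 0 => fun _ => 1
  | 1 => fun x => ((2 * lam : ℝ) : ℂ) * (x (Fin.last e) : ℂ)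
  | m + 2 => fun x => ((1 / ((m : ℝ) + 2) : ℝ) : ℂ) *
      (((2 * ((m : ℝ) + 1 + lam) : ℝ) : ℂ) * (x (Fin.last e) : ℂ) * homGegenbauer lam (m + 1) x -
        (((m : ℝ) + 2 * lam : ℝ) : ℂ) * (∑ i, (x i : ℂ) ^ 2) * homGegenbauer lam m x)

theorem isHom_homGegenbauer {e : ℕ} (lam : ℝ) (a : ℕ) :
    IsHom (e + 1) a (homGegenbauer (e := e) lam a) := by
  induction a using Nat.strong_induction_on with
  | _ a ih =>
    rcases a with _ | _ | a
    · exact IsHom.const 1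
    · exact (IsHom.coord _).const_mul _
    · refine IsHom.const_mul _ (IsHom.sub ?_ ?_)
      · exact (((IsHom.coord _).const_mul _).mul (ih (a + 1) (by omega))).congr_degree (by omega)
      · have h : IsHom (e + 1) 2 fun x => ∑ i, (x i : ℂ) ^ 2 :=
          IsHom.sum _ _ fun i _ => (IsHom.coord i).pow 2
        exact ((h.const_mul _).mul (ih a (by omega))).congr_degree (by omega)

theorem homGegenbauer_eq {e : ℕ} (lam : ℝ) (a : ℕ) {x : EuclideanSpace ℝ (Fin (e + 1))}
    (hx : x ≠ 0) : homGegenbauer lam a x =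
      ((‖x‖ ^ a * (gegenbauer lam a).eval (x (Fin.last e) / ‖x‖) : ℝ) : ℂ) := by
  have hx' : ‖x‖ ≠ 0 := norm_ne_zero_iff.2 hx
  have hs : (∑ i, (x i : ℂ) ^ 2) = ((‖x‖ ^ 2 : ℝ) : ℂ) := by
    rw [EuclideanSpace.norm_sq_eq]
    simp [← Complex.ofReal_pow]
  induction a using Nat.strong_induction_on with
  | _ a ih =>
    rcases a with _ | _ | a
    · simp [homGegenbauer, gegenbauer]
    · simp only [homGegenbauer]
      rw [← Complex.ofReal_mul]
      congr 1
      simp [gegenbauer]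
      field_simp
    · simp only [homGegenbauer]
      rw [ih (a + 1) (by omega), ih a (by omega), hs]
      simp only [← Complex.ofReal_mul, ← Complex.ofReal_sub]
      congr 1
      simp only [gegenbauer, Polynomial.eval_mul, Polynomial.eval_C, Polynomial.eval_sub,
        Polynomial.eval_X]
      field_simp
      ring

/-! ### Spherical coordinates under projection, and solid harmonics -/

theorem coord_initCoords {e : ℕ} (x : EuclideanSpace ℝ (Fin (e + 1))) {i : ℕ} (hi : i < e) :
    coord (initCoords x) i = coord x i := by
  rw [coord, coord, dif_pos hi, dif_pos (by omega)]
  rfl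

theorem radius_initCoords {e : ℕ} (x : EuclideanSpace ℝ (Fin (e + 1))) {i : ℕ} (hi : i < e) :
    radius (initCoords x) i = radius x i := by
  rw [radius, radius]
  congr 1
  refine Finset.sum_congr rfl fun l hl => ?_
  rw [coord_initCoords x (by have := Finset.mem_range.1 hl; omega)]

theorem angle_initCoords {e : ℕ} (x : EuclideanSpace ℝ (Fin (e + 1))) {i : ℕ} (hi1 : 1 ≤ i)
    (hi : i < e) : angle (initCoords x) i = angle x i := by
  rw [angle, angle, coord_initCoords x hi, coord_initCoords x (by omega : 0 < e),
    radius_initCoords x hi]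
  split_ifs with h
  · subst h
    rw [coord_initCoords x hi]
  · rfl

theorem radius_last {e : ℕ} (x : EuclideanSpace ℝ (Fin (e + 1))) : radius x e = ‖x‖ := by
  rw [radius, EuclideanSpace.norm_eq, ← Fin.sum_univ_eq_sum_range (fun l => coord x l ^ 2)]
  simp only [coord, Fin.is_lt, dif_pos, Fin.eta, Real.norm_eq_abs, sq_abs]

/-- `f` is the homogeneous polynomial of degree `n` whose restriction to the sphere is given by
the function `F` of the spherical coordinates; it is orthogonal to polynomials of lower degree. -/
structure IsSolid (d n : ℕ) (F : (ℕ → ℝ) → ℂ) (f : EuclideanSpace ℝ (Fin d) → ℂ) : Prop where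
  hom : IsHom d n f
  orth : IsOrthLower d n f
  angles : ∀ θ θ' : ℕ → ℝ, (∀ i, 1 ≤ i → i < d → θ i = θ' i) → F θ = F θ'
  eq : ∀ y, (‖y‖ : ℂ) ^ n * F (angle y) = f y

theorem IsSolid.eq_sphere {d n : ℕ} {F : (ℕ → ℝ) → ℂ} {f : EuclideanSpace ℝ (Fin d) → ℂ}
    (h : IsSolid d n F f) (x : Sph d) : F (angle x.1) = f x.1 := by
  simpa using h.eq x.1

theorem IsOrthLower.const_mul {d n : ℕ} {f : EuclideanSpace ℝ (Fin d) → ℂ}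
    (h : IsOrthLower d n f) (c : ℂ) : IsOrthLower d n fun x => c * f x := by
  intro j hj g hg
  simp only [map_mul, mul_left_comm _ (conj c)]
  rw [integral_const_mul, h j hj g hg, mul_zero]

theorem IsSolid.const_mul {d n : ℕ} {F : (ℕ → ℝ) → ℂ} {f : EuclideanSpace ℝ (Fin d) → ℂ}
    (h : IsSolid d n F f) (c : ℂ) : IsSolid d n (fun θ => c * F θ) (fun x => c * f x) where
  hom := h.hom.const_mul c
  orth := h.orth.const_mul c
  angles θ θ' hθ := by simp only [h.angles θ θ' hθ]
  eq y := by rw [← h.eq]; ring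

/-- The dependence on the last angle of the spherical harmonics in one dimension more. -/
def stepAng (e m a : ℕ) (F : (ℕ → ℝ) → ℂ) (θ : ℕ → ℝ) : ℂ :=
  (((gegenbauer (((e : ℝ) - 1) / 2 + m) a).eval (Real.cos (θ e)) * Real.sin (θ e) ^ m : ℝ) : ℂ) *
    F θ

/-- With `θ_e` the last angle, `y_last = ‖y‖ cos θ_e` and `‖initCoords y‖ = ‖y‖ sin θ_e`, while the
lower angles of `y` and `initCoords y` agree. So `sin^m θ_e` is just what turns `‖y‖^m` into the
factor `‖initCoords y‖^m` required by the solid polynomial one dimension below. -/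
theorem IsSolid.step {e m : ℕ} (he : 2 ≤ e) {F : (ℕ → ℝ) → ℂ}
    {f : EuclideanSpace ℝ (Fin e) → ℂ} (h : IsSolid e m F f) (a : ℕ) :
    IsSolid (e + 1) (m + a) (stepAng e m a F)
      fun x => homGegenbauer (((e : ℝ) - 1) / 2 + m) a x * f (initCoords x) := by
  have : NeZero e := ⟨by omega⟩
  have hdeg : IsHom (e + 1) (m + a)
      fun x => homGegenbauer (((e : ℝ) - 1) / 2 + m) a x * f (initCoords x) :=
    ((isHom_homGegenbauer _ a).mul h.hom.comp_init).congr_degree (add_comm a m)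
  refine ⟨hdeg, ?_, ?_, ?_⟩
  · refine h.hom.orthLower_slice he h.orth a fun x => ?_
    have hx : x.1 ≠ 0 := by
      rw [← norm_ne_zero_iff]
      simp
    rw [homGegenbauer_eq _ _ hx]
    simp
  · intro θ θ' hθ
    rw [stepAng, stepAng, hθ e (by omega) (by omega),
      h.angles θ θ' fun i h1 h2 => hθ i h1 (by omega)]
  · intro y
    have hF : F (angle y) = F (angle (initCoords y)) :=
      h.angles _ _ fun i h1 h2 => (angle_initCoords y h1 h2).symm
    have heq := h.eq (initCoords y)
    rw [stepAng, hF]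
    -- `homGegenbauer_eq` fails to apply at the origin. There both sides vanish by homogeneity,
    -- except in degree zero, where they reduce to the same value.
    by_cases hy : y = 0
    · rcases Nat.eq_zero_or_pos (m + a) with h0 | h0
      · obtain ⟨rfl, rfl⟩ : m = 0 ∧ a = 0 := by omega
        rw [← heq]
        simp [gegenbauer, homGegenbauer]
      · have h1 := hdeg.map_smul 0 0
        simp only [smul_zero, Complex.ofReal_zero, zero_pow h0.ne', zero_mul] at h1
        rw [hy, h1, norm_zero, Complex.ofReal_zero, zero_pow h0.ne', zero_mul]
    · have hy' : ‖y‖ ≠ 0 := norm_ne_zero_iff.2 hy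
      have hcos : Real.cos (angle y e) = y (Fin.last e) / ‖y‖ := by
        have h1 := radius_mul_cos y he
        rw [radius_last] at h1
        rw [eq_div_iff hy', mul_comm, h1]
        simp [coord, Fin.last]
      have hsin : ‖y‖ * Real.sin (angle y e) = ‖initCoords y‖ := by
        obtain ⟨i, rfl⟩ : ∃ i, e = i + 1 := ⟨e - 1, by omega⟩
        have h1 := radius_mul_sin y (i := i) (by omega)
        rw [radius_last] at h1
        rw [h1, ← radius_initCoords y (Nat.lt_succ_self i), radius_last]
      rw [homGegenbauer_eq _ _ hy, ← heq, ← hsin, hcos]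
      push_cast
      ring

theorem stepAng_angle {e m : ℕ} (he : 2 ≤ e) {F : (ℕ → ℝ) → ℂ}
    {f : EuclideanSpace ℝ (Fin e) → ℂ} (h : IsSolid e m F f) (a : ℕ) (x : Sph (e + 1)) :
    stepAng e m a F (angle x.1) =
      (((gegenbauer (((e : ℝ) - 1) / 2 + m) a).eval (x.1 (Fin.last e)) : ℝ) : ℂ) *
        f (initCoords x.1) := by
  have hx : x.1 ≠ 0 := by
    rw [← norm_ne_zero_iff]
    simp
  rw [(h.step he a).eq_sphere x, homGegenbauer_eq _ _ hx]
  simp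

/-- The function `e^{ikθ₁}` of the angles. -/
def circAng (k : ℤ) (θ : ℕ → ℝ) : ℂ := Complex.exp (Complex.I * (k : ℂ) * (θ 1 : ℂ))

theorem isSolid_circ (k : ℤ) : IsSolid 2 k.natAbs (circAng k) (circFun k) where
  hom := isHom_circFun k
  orth := orthLower_circFun k
  angles θ θ' hθ := by rw [circAng, circAng, hθ 1 le_rfl (by norm_num)]
  eq y := by
    have h1 : angle y 1 = Complex.arg (circNum y) := by
      simp [angle, coord, circNum]
    have h2 := Complex.norm_mul_exp_arg_mul_I (circNum y)
    rw [norm_circNum] at h2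
    have h3 : (‖y‖ : ℂ) * Complex.exp (-(Complex.arg (circNum y) * Complex.I)) =
        conj (circNum y) := by
      rw [← h2, map_mul, Complex.conj_ofReal, ← Complex.exp_conj, h2]
      simp
    rw [circAng, h1, circFun]
    split_ifs with h
    · rw [← h2, mul_pow, ← Complex.exp_nat_mul, h2]
      congr 2
      have : (k.natAbs : ℂ) = (k : ℂ) := by
        rw [← Int.cast_natCast, Int.natAbs_of_nonneg h]
      rw [this]
      ring
    · rw [← h3, mul_pow, ← Complex.exp_nat_mul]
      congr 2
      have : (k.natAbs : ℂ) = -(k : ℂ) := by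
        rw [← Int.cast_natCast, Int.ofNat_natAbs_of_nonpos (by omega), Int.cast_neg]
      rw [this]
      ring

/-! ### Multi-indices -/

/-- Prepending `m` shifts the chain by one, so the entry `m` plays the role of `k₀` one dimension
below. All recursions over the dimension use this shift. -/
theorem ent_consIdx {e : ℕ} (he : 2 ≤ e) (n m : ℕ) (k : Idx e) (j : ℕ) :
    ent n (consIdx (d := e + 1) m k) (j + 1) = ent m k j := by
  rcases j with _ | j
  · have : 0 < e + 1 - 2 := by omega
    simp only [ent, dif_pos this]
    simp [consIdx]
  · by_cases h : j < e - 2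
    · have : j + 1 < e + 1 - 2 := by omega
      simp only [ent, dif_pos this, dif_pos h]
      simp [consIdx]
    · have : ¬ j + 1 < e + 1 - 2 := by omega
      simp only [ent, dif_neg this, dif_neg h]

theorem consIdx_mem {e : ℕ} (he : 2 ≤ e) {n m : ℕ} {k : Idx e} :
    consIdx (d := e + 1) m k ∈ idxSet (e + 1) n ↔ m ≤ n ∧ k ∈ idxSet e m := by
  rw [mem_idxSet, mem_idxSet]
  constructor
  · intro h
    refine ⟨?_, fun j hj => ?_⟩
    · have := h 0 (by omega)
      rw [ent_consIdx he] at this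
      simpa [ent] using this
    · have := h (j + 1) (by omega)
      rwa [ent_consIdx he, ent_consIdx he] at this
  · rintro ⟨hm, h⟩ j hj
    rcases j with _ | j
    · rw [ent_consIdx he]
      simpa [ent] using hm
    · rw [ent_consIdx he, ent_consIdx he]
      exact h j (by omega)

theorem consIdx_injective {e : ℕ} (he : 2 ≤ e) {m m' : ℕ} {k k' : Idx e}
    (h : consIdx (d := e + 1) m k = consIdx (d := e + 1) m' k') : m = m' ∧ k = k' := by
  have h0 (j : ℕ) : ent m k j = ent m' k' j := by
    rw [← ent_consIdx he 0 m k j, ← ent_consIdx he 0 m' k' j, h]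
  refine ⟨by simpa [ent] using h0 0, ?_⟩
  funext i
  simpa [ent] using h0 (i + 1)

/-- For `e ≥ 3` the chain contains `|k₂| ≤ k₁`, which forces `k₁ ≥ 0`. For `e = 2` the first entry
is also the last and may be negative, so dimension three is treated separately. -/
theorem exists_consIdx {e : ℕ} (he : 3 ≤ e) {n : ℕ} {k : Idx (e + 1)} (hk : k ∈ idxSet (e + 1) n) :
    ∃ (m : ℕ) (k' : Idx e), k = consIdx (d := e + 1) m k' ∧ m ≤ n ∧ k' ∈ idxSet e m := by
  have h1 := mem_idxSet.1 hk 1 (by omega)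
  have h2 : 0 ≤ ent n k 1 := (abs_nonneg _).trans h1
  obtain ⟨m, hm⟩ := Int.eq_ofNat_of_zero_le h2
  have h01 : 0 < e + 1 - 2 := by omega
  have hm' : k ⟨0, h01⟩ = m := by simpa only [ent, dif_pos h01] using hm
  have hk' : k = consIdx (d := e + 1) m fun i : Fin (e - 2) => k ⟨i + 1, by omega⟩ := by
    funext i
    rcases i with ⟨_ | i, hi⟩
    · simpa [consIdx] using hm'
    · simp [consIdx]
  refine ⟨m, _, hk', ?_⟩
  rw [hk', consIdx_mem (by omega)] at hk
  exact hk

theorem sum_idxSet_succ {e : ℕ} (he : 3 ≤ e) (n : ℕ) (G : Idx (e + 1) → ℂ) :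
    ∑ k ∈ idxSet (e + 1) n, G k =
      ∑ m ∈ Finset.range (n + 1), ∑ k ∈ idxSet e m, G (consIdx (d := e + 1) m k) := by
  rw [Finset.sum_sigma']
  symm
  refine Finset.sum_bij (fun p _ => consIdx (d := e + 1) (p.1 : ℕ) p.2) ?_ ?_ ?_ ?_
  · rintro ⟨m, k⟩ hp
    rw [Finset.mem_sigma, Finset.mem_range] at hp
    exact (consIdx_mem (by omega)).2 ⟨Nat.lt_succ_iff.1 hp.1, hp.2⟩
  · rintro ⟨m, k⟩ - ⟨m', k'⟩ - h
    obtain ⟨rfl, rfl⟩ := consIdx_injective (by omega) h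
    rfl
  · intro k hk
    obtain ⟨m, k', rfl, hm, hk'⟩ := exists_consIdx he hk
    exact ⟨⟨m, k'⟩, Finset.mem_sigma.2 ⟨Finset.mem_range.2 (Nat.lt_succ_of_le hm), hk'⟩, rfl⟩
  · intro p _
    rfl

theorem sum_idxSet_three (n : ℕ) (G : Idx 3 → ℂ) :
    ∑ k ∈ idxSet 3 n, G k = ∑ k ∈ Finset.Icc (-(n : ℤ)) n, G fun _ => k := by
  have hmem (k : Idx 3) : k ∈ idxSet 3 n ↔ |k 0| ≤ n := by
    rw [mem_idxSet]
    constructor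
    · intro h
      simpa [ent] using h 0 (by norm_num)
    · intro h j hj
      obtain rfl : j = 0 := by omega
      simpa [ent] using h
  symm
  refine Finset.sum_bij (fun k _ => fun _ => k) ?_ ?_ ?_ ?_
  · intro k hk
    rw [hmem]
    exact abs_le.2 (Finset.mem_Icc.1 hk)
  · intro k _ k' _ h
    exact congrFun h 0
  · intro k hk
    refine ⟨k 0, Finset.mem_Icc.2 (abs_le.1 ((hmem k).1 hk)), ?_⟩
    funext i
    rw [Subsingleton.elim (α := Fin 1) i 0]
  · intro k _
    rfl

/-! ### The normalization factors -/

/-- The quotient of the squared normalization factors in dimensions `e + 1` and `e`. -/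
def stepNormSq (e m a : ℕ) : ℝ :=
  (2 : ℝ) ^ ((e : ℤ) - 3) * (Real.Gamma ((e : ℝ) / 2) / Real.Gamma (((e : ℝ) + 1) / 2)) *
    ((2 : ℝ) ^ (2 * m) * (a.factorial : ℝ) * (2 * ((m : ℝ) + a) + e - 1) *
      Real.Gamma (((e : ℝ) - 1) / 2 + m) ^ 2 /
        (Real.sqrt Real.pi * Real.Gamma (2 * (m : ℝ) + a + e - 1)))

theorem stepNormSq_nonneg {e : ℕ} (he : 2 ≤ e) (m a : ℕ) : 0 ≤ stepNormSq e m a := by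
  have h1 : (2 : ℝ) ≤ e := by exact_mod_cast he
  have hm := Nat.cast_nonneg (α := ℝ) m
  have ha := Nat.cast_nonneg (α := ℝ) a
  have h2 : 0 < Real.Gamma ((e : ℝ) / 2) := Real.Gamma_pos_of_pos (by positivity)
  have h3 : 0 < Real.Gamma (((e : ℝ) + 1) / 2) := Real.Gamma_pos_of_pos (by positivity)
  have h4 : 0 < Real.Gamma (2 * (m : ℝ) + a + e - 1) := Real.Gamma_pos_of_pos (by linarith)
  have h5 : 0 ≤ 2 * ((m : ℝ) + a) + e - 1 := by linarith
  unfold stepNormSq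
  positivity

/-- This is the check of the constant `A_k^n`: the quotient of squared normalizations is inverse to
the slice integral of the squared Gegenbauer factor. -/
theorem stepNormSq_mul {e : ℕ} (he : 2 ≤ e) (m a : ℕ) :
    stepNormSq e m a * (sliceConst e * betaInt (((e : ℝ) - 1) / 2 + m + 1 / 2)
      (gegenbauer (((e : ℝ) - 1) / 2 + m) a * gegenbauer (((e : ℝ) - 1) / 2 + m) a)) = 1 := by
  have h1 : (2 : ℝ) ≤ e := by exact_mod_cast he
  have hm := Nat.cast_nonneg (α := ℝ) m
  have ha := Nat.cast_nonneg (α := ℝ) a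
  have hl : 0 < ((e : ℝ) - 1) / 2 + m := by linarith
  have h2 := (Real.Gamma_pos_of_pos (show 0 < (e : ℝ) / 2 by positivity)).ne'
  have h3 := (Real.Gamma_pos_of_pos (show 0 < ((e : ℝ) + 1) / 2 by positivity)).ne'
  have h4 := (Real.Gamma_pos_of_pos (show 0 < 2 * (m : ℝ) + a + e - 1 by linarith)).ne'
  have h5 := (Real.Gamma_pos_of_pos hl).ne'
  have h6 : a + (((e : ℝ) - 1) / 2 + m) ≠ 0 := by linarith
  have hsq := betaInt_gegenbauer_sq hl a
  have harg : (a : ℝ) + 2 * (((e : ℝ) - 1) / 2 + m) = 2 * (m : ℝ) + a + e - 1 := by ring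
  rw [harg] at hsq
  -- All powers of two cancel: with `λ = (e-1)/2 + m`, `1 - 2λ = 2 - e - 2m`. The last factor `2` is
  -- the one split off in `hlin`.
  have hpow : (2 : ℝ) ^ (1 - 2 * (((e : ℝ) - 1) / 2 + m)) * ((2 : ℝ) ^ ((e : ℤ) - 3) *
      (2 : ℝ) ^ (2 * m) * 2) = 1 := by
    rw [← Real.rpow_intCast, ← Real.rpow_natCast, ← Real.rpow_add two_pos,
      ← Real.rpow_add_one two_ne_zero, ← Real.rpow_add two_pos, ← Real.rpow_zero 2]
    congr 1
    push_cast
    ring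
  have hπ : Real.sqrt Real.pi * Real.sqrt Real.pi = Real.pi := Real.mul_self_sqrt Real.pi_pos.le
  have hπ' : Real.sqrt Real.pi ≠ 0 := (Real.sqrt_pos.2 Real.pi_pos).ne'
  unfold stepNormSq sliceConst
  have hlin : 2 * ((m : ℝ) + a) + e - 1 = 2 * (a + (((e : ℝ) - 1) / 2 + m)) := by ring
  rw [hlin]
  generalize betaInt (((e : ℝ) - 1) / 2 + m + 1 / 2) (gegenbauer (((e : ℝ) - 1) / 2 + m) a *
    gegenbauer (((e : ℝ) - 1) / 2 + m) a) = B at hsq ⊢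
  generalize (2 : ℝ) ^ (1 - 2 * (((e : ℝ) - 1) / 2 + m)) = P at hsq hpow
  generalize (2 : ℝ) ^ ((e : ℤ) - 3) = Q at hpow ⊢
  generalize (2 : ℝ) ^ (2 * m) = R at hpow ⊢
  generalize Real.Gamma ((e : ℝ) / 2) = G2 at *
  generalize Real.Gamma (((e : ℝ) + 1) / 2) = G3 at *
  generalize Real.Gamma (2 * (m : ℝ) + a + e - 1) = G4 at *
  generalize Real.Gamma (((e : ℝ) - 1) / 2 + m) = G5 at *
  generalize (a : ℝ) + (((e : ℝ) - 1) / 2 + m) = L at *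
  generalize Real.sqrt Real.pi = S at *
  generalize (a.factorial : ℝ) = A at *
  field_simp
  rw [← hπ] at hsq
  linear_combination (Q * R * 2) * hsq + S ^ 2 * G4 * hpow

/-- The factor `j = 0` of the product depends only on `m` and `a` and goes into `stepNormSq`. The
factor `j + 1` is half the factor `j` one dimension below, because of `2^{-j}`. -/
theorem normSq_consIdx {e : ℕ} (he : 2 ≤ e) (m a : ℕ) (k : Idx e) :
    normSq (e + 1) (m + a) (consIdx (d := e + 1) m k) = stepNormSq e m a * normSq e m k := by
  obtain ⟨s, rfl⟩ := Nat.exists_eq_add_of_le' he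
  have hs : s + 2 + 1 - 2 = s + 1 := rfl
  have hs' : s + 2 - 2 = s := rfl
  have hG := (Real.Gamma_pos_of_pos (show 0 < ((s + 2 : ℕ) : ℝ) / 2 by positivity)).ne'
  have h0 : ent (m + a) (consIdx (d := s + 2 + 1) m k) 0 = (m + a : ℕ) := rfl
  unfold normSq
  rw [hs, hs', Finset.prod_range_succ', ent_consIdx he, h0]
  have hprod : ∀ j ∈ Finset.range s,
      (2 : ℝ) ^ (2 * |ent (m + a) (consIdx (d := s + 2 + 1) m k) (j + 1 + 1)| - ((j + 1 : ℕ) : ℤ)) *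
          ((ent (m + a) (consIdx (d := s + 2 + 1) m k) (j + 1) -
            |ent (m + a) (consIdx (d := s + 2 + 1) m k) (j + 1 + 1)|).toNat.factorial : ℝ) *
          (2 * (ent (m + a) (consIdx (d := s + 2 + 1) m k) (j + 1) : ℝ) + ((s + 2 + 1 : ℕ) : ℝ)
            - ((j + 1 : ℕ) : ℝ) - 2) *
          Real.Gamma ((((s + 2 + 1 : ℕ) : ℝ) - ((j + 1 : ℕ) : ℝ) - 2) / 2 +
            |(ent (m + a) (consIdx (d := s + 2 + 1) m k) (j + 1 + 1) : ℝ)|) ^ 2 /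
        (Real.sqrt Real.pi *
          Real.Gamma ((ent (m + a) (consIdx (d := s + 2 + 1) m k) (j + 1) : ℝ) +
            |(ent (m + a) (consIdx (d := s + 2 + 1) m k) (j + 1 + 1) : ℝ)| +
              ((s + 2 + 1 : ℕ) : ℝ) - ((j + 1 : ℕ) : ℝ) - 2)) =
      (1 / 2 : ℝ) * ((2 : ℝ) ^ (2 * |ent m k (j + 1)| - (j : ℤ)) *
          ((ent m k j - |ent m k (j + 1)|).toNat.factorial : ℝ) *
          (2 * (ent m k j : ℝ) + ((s + 2 : ℕ) : ℝ) - j - 2) *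
          Real.Gamma ((((s + 2 : ℕ) : ℝ) - j - 2) / 2 + |(ent m k (j + 1) : ℝ)|) ^ 2 /
        (Real.sqrt Real.pi *
          Real.Gamma ((ent m k j : ℝ) + |(ent m k (j + 1) : ℝ)| + ((s + 2 : ℕ) : ℝ) - j - 2))) := by
    intro j _
    rw [ent_consIdx he, ent_consIdx he]
    have e1 (x : ℝ) : x + ((s + 2 + 1 : ℕ) : ℝ) - ((j + 1 : ℕ) : ℝ) - 2 =
        x + ((s + 2 : ℕ) : ℝ) - j - 2 := by push_cast; ring
    have e2 : ((s + 2 + 1 : ℕ) : ℝ) - ((j + 1 : ℕ) : ℝ) - 2 = ((s + 2 : ℕ) : ℝ) - j - 2 := by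
      push_cast; ring
    have e3 : 2 * |ent m k (j + 1)| - ((j + 1 : ℕ) : ℤ) = (2 * |ent m k (j + 1)| - (j : ℤ)) - 1 := by
      push_cast; ring
    rw [e1, e1, e2, e3, zpow_sub_one₀ two_ne_zero]
    ring
  rw [Finset.prod_congr rfl hprod, Finset.prod_mul_distrib, Finset.prod_const, Finset.card_range]
  generalize (∏ j ∈ Finset.range s, _ : ℝ) = P
  have hent : ent m k 0 = (m : ℤ) := rfl
  have habs : |((m : ℕ) : ℤ)| = (m : ℤ) := abs_of_nonneg (by positivity)
  have habs' : |(((m : ℕ) : ℤ) : ℝ)| = (m : ℝ) := by simp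
  have htn : (((m + a : ℕ) : ℤ) - (m : ℤ)).toNat = a := by omega
  rw [hent, habs, habs', htn]
  unfold stepNormSq
  have e4 : (((s + 2 + 1 : ℕ) : ℝ) - ((0 : ℕ) : ℝ) - 2) / 2 + (m : ℝ) =
      (((s + 2 : ℕ) : ℝ) - 1) / 2 + m := by push_cast; ring
  have e5 : (((m + a : ℕ) : ℤ) : ℝ) + (m : ℝ) + ((s + 2 + 1 : ℕ) : ℝ) - ((0 : ℕ) : ℝ) - 2 =
      2 * (m : ℝ) + a + ((s + 2 : ℕ) : ℝ) - 1 := by push_cast; ring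
  have e6 : 2 * (((m + a : ℕ) : ℤ) : ℝ) + ((s + 2 + 1 : ℕ) : ℝ) - ((0 : ℕ) : ℝ) - 2 =
      2 * ((m : ℝ) + a) + ((s + 2 : ℕ) : ℝ) - 1 := by push_cast; ring
  have e7 : ((s + 2 + 1 : ℕ) : ℝ) / 2 = (((s + 2 : ℕ) : ℝ) + 1) / 2 := by push_cast; ring
  have e8 : (2 : ℝ) ^ (2 * (m : ℤ) - ((0 : ℕ) : ℤ)) = (2 : ℝ) ^ (2 * m) := by
    rw [← zpow_natCast]
    congr 1
  -- The `s = e - 2` halves balance the leading powers: `(e-3)(e-1) - (e-2) = (e-3) + (e-4)(e-2)`.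
  have e9 : (2 : ℝ) ^ ((((s + 2 + 1 : ℕ) : ℤ) - 4) * (((s + 2 + 1 : ℕ) : ℤ) - 2)) * (1 / 2) ^ s =
      (2 : ℝ) ^ (((s + 2 : ℕ) : ℤ) - 3) *
        (2 : ℝ) ^ ((((s + 2 : ℕ) : ℤ) - 4) * (((s + 2 : ℕ) : ℤ) - 2)) := by
    rw [one_div, inv_pow, ← zpow_natCast, ← zpow_neg, ← zpow_add₀ two_ne_zero,
      ← zpow_add₀ two_ne_zero]
    congr 1
    push_cast
    ring
  rw [e4, e5, e6, e7, e8]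
  generalize Real.Gamma (((s + 2 : ℕ) : ℝ) / 2) = G1 at hG ⊢
  generalize Real.Gamma ((((s + 2 : ℕ) : ℝ) + 1) / 2) = G2
  generalize (2 : ℝ) ^ (2 * m) * _ * _ * _ / _ = Z
  have e10 : ∀ A B C D : ℝ, A * B = C * D →
      A / G2 * (B * P * Z) = C * (G1 / G2) * Z * (D / G1 * P) := by
    intro A B C D h
    have : C * (G1 / G2) * Z * (D / G1 * P) = (C * D) * (P * Z / G2) := by
      field_simp
    rw [this, ← h]
    ring
  exact e10 _ _ _ _ e9

theorem harmonicAng_consIdx {e : ℕ} (he : 2 ≤ e) (m a : ℕ) (k : Idx e) :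
    harmonicAng (e + 1) (m + a) (consIdx (d := e + 1) m k) =
      fun θ => (Real.sqrt (stepNormSq e m a) : ℂ) * stepAng e m a (harmonicAng e m k) θ := by
  funext θ
  have hs : e + 1 - 2 = (e - 2) + 1 := by omega
  have h0 : ent (m + a) (consIdx (d := e + 1) m k) 0 = (m + a : ℕ) := rfl
  have hent : ent m k 0 = (m : ℤ) := rfl
  unfold harmonicAng
  rw [normSq_consIdx he, Real.sqrt_mul (stepNormSq_nonneg he m a), hs, Finset.prod_range_succ',
    ent_consIdx he, ent_consIdx he, h0, hent]
  have hprod : ∀ j ∈ Finset.range (e - 2),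
      (((gegenbauer ((((e + 1 : ℕ) : ℝ) - ((j + 1 : ℕ) : ℝ) - 2) / 2 +
            |(ent (m + a) (consIdx (d := e + 1) m k) (j + 1 + 1) : ℝ)|)
            (ent (m + a) (consIdx (d := e + 1) m k) (j + 1) -
              |ent (m + a) (consIdx (d := e + 1) m k) (j + 1 + 1)|).toNat).eval
              (Real.cos (θ (e + 1 - (j + 1) - 1))) *
          Real.sin (θ (e + 1 - (j + 1) - 1)) ^
            (ent (m + a) (consIdx (d := e + 1) m k) (j + 1 + 1)).natAbs : ℝ) : ℂ) =
      (((gegenbauer (((e : ℝ) - j - 2) / 2 + |(ent m k (j + 1) : ℝ)|)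
            (ent m k j - |ent m k (j + 1)|).toNat).eval (Real.cos (θ (e - j - 1))) *
          Real.sin (θ (e - j - 1)) ^ (ent m k (j + 1)).natAbs : ℝ) : ℂ) := by
    intro j _
    have e1 : e + 1 - (j + 1) - 1 = e - j - 1 := by omega
    have e2 : ((e + 1 : ℕ) : ℝ) - ((j + 1 : ℕ) : ℝ) - 2 = (e : ℝ) - j - 2 := by push_cast; ring
    rw [ent_consIdx he, ent_consIdx he, e1, e2]
  rw [Finset.prod_congr rfl hprod]
  have habs : |((m : ℕ) : ℤ)| = (m : ℤ) := abs_of_nonneg (by positivity)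
  have habs' : |(((m : ℕ) : ℤ) : ℝ)| = (m : ℝ) := by simp
  have htn : (((m + a : ℕ) : ℤ) - (m : ℤ)).toNat = a := by omega
  have e3 : (((e + 1 : ℕ) : ℝ) - ((0 : ℕ) : ℝ) - 2) / 2 + (m : ℝ) = ((e : ℝ) - 1) / 2 + m := by
    push_cast; ring
  have e4 : e + 1 - 0 - 1 = e := rfl
  rw [habs, habs', htn, e3, e4, Int.natAbs_natCast, stepAng]
  push_cast
  ring

/-- The base of the recursion: the lower harmonic is the Fourier mode `e^{ikθ₁}`, whose solid
polynomial has degree `|k|` for either sign of `k`. -/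
theorem harmonicAng_three (k : ℤ) (a : ℕ) :
    harmonicAng 3 (k.natAbs + a) (fun _ => k) =
      fun θ => (Real.sqrt (stepNormSq 2 k.natAbs a) : ℂ) * stepAng 2 k.natAbs a (circAng k) θ := by
  funext θ
  have h0 : ent (d := 3) (k.natAbs + a) (fun _ => k) 0 = (k.natAbs + a : ℕ) := rfl
  have h1 : ent (d := 3) (k.natAbs + a) (fun _ => k) 1 = k := rfl
  have habs : |k| = (k.natAbs : ℤ) := Int.abs_eq_natAbs k
  have habs' : |(k : ℝ)| = (k.natAbs : ℝ) := by
    rw [← Int.cast_abs, habs, Int.cast_natCast]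
  have htn : (((k.natAbs + a : ℕ) : ℤ) - (k.natAbs : ℤ)).toNat = a := by omega
  have e3 : (((3 : ℕ) : ℝ) - ((0 : ℕ) : ℝ) - 2) / 2 + (k.natAbs : ℝ) =
      (((2 : ℕ) : ℝ) - 1) / 2 + k.natAbs := by
    push_cast; ring
  have hn : normSq 3 (k.natAbs + a) (fun _ => k) = stepNormSq 2 k.natAbs a := by
    have e5 (b : ℕ) : (((b + a : ℕ) : ℤ) : ℝ) + (b : ℝ) + ((3 : ℕ) : ℝ) - ((0 : ℕ) : ℝ) - 2 =
        2 * (b : ℝ) + a + ((2 : ℕ) : ℝ) - 1 := by push_cast; ring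
    have e6 (b : ℕ) : 2 * (((b + a : ℕ) : ℤ) : ℝ) + ((3 : ℕ) : ℝ) - ((0 : ℕ) : ℝ) - 2 =
        2 * ((b : ℝ) + a) + ((2 : ℕ) : ℝ) - 1 := by push_cast; ring
    have e7 : (((2 : ℕ) : ℝ) + 1) / 2 = ((3 : ℕ) : ℝ) / 2 := by norm_num
    have e8 : (2 : ℝ) ^ (2 * (k.natAbs : ℤ) - ((0 : ℕ) : ℤ)) = (2 : ℝ) ^ (2 * k.natAbs) := by
      rw [← zpow_natCast]
      congr 1
    have e9 : ((2 : ℕ) : ℝ) / 2 = 1 := by norm_num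
    have e10 : (((3 : ℕ) : ℤ) - 4) * (((3 : ℕ) : ℤ) - 2) = ((2 : ℕ) : ℤ) - 3 := by norm_num
    have hr (F : ℕ → ℝ) : ∏ j ∈ Finset.range (3 - 2), F j = F 0 := Finset.prod_range_one F
    unfold normSq stepNormSq
    rw [hr, h0, zero_add, h1, habs, habs', htn, e3, e5, e6, e7, e8, e9, e10, Real.Gamma_one]
    ring
  have hr (F : ℕ → ℂ) : ∏ j ∈ Finset.range (3 - 2), F j = F 0 := Finset.prod_range_one F
  unfold harmonicAng
  rw [hn, hr, h0, zero_add, h1, habs, habs', htn, e3, stepAng, circAng]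
  simp only [Nat.sub_zero, show 3 - 1 = 2 from rfl, mul_assoc]

theorem exists_isSolid (d n : ℕ) (hd : 3 ≤ d) (k : Idx d) (hk : k ∈ idxSet d n) :
    ∃ f, IsSolid d n (harmonicAng d n k) f := by
  induction d, hd using Nat.le_induction generalizing n with
  | base =>
    have h0 : |k 0| ≤ n := by
      simpa [ent] using mem_idxSet.1 hk 0 (by norm_num)
    have h1 : k = fun _ => k 0 := by
      funext i
      rw [Subsingleton.elim (α := Fin 1) i 0]
    obtain ⟨a, rfl⟩ : ∃ a, n = (k 0).natAbs + a := ⟨n - (k 0).natAbs, by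
      rw [Int.abs_eq_natAbs] at h0
      omega⟩
    rw [h1, harmonicAng_three]
    exact ⟨_, ((isSolid_circ (k 0)).step le_rfl a).const_mul _⟩
  | succ e he ih =>
    obtain ⟨m, k', rfl, hm, hk'⟩ := exists_consIdx he hk
    obtain ⟨f, hf⟩ := ih m k' hk'
    obtain ⟨a, rfl⟩ := Nat.exists_eq_add_of_le hm
    rw [harmonicAng_consIdx (by omega)]
    exact ⟨_, (hf.step (by omega) a).const_mul _⟩

/-! ### Matrix coefficients at rotations that fix the last basis vector -/

theorem initCoords_emb {e : ℕ} (h : SO e) (x : EuclideanSpace ℝ (Fin (e + 1))) :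
    initCoords (rotIsometry (emb (d := e + 1) h) x) = rotIsometry h (initCoords x) := by
  rw [rotIsometry_apply, rotIsometry_apply]
  ext i
  simp only [initCoords, Matrix.mulVec, dotProduct, Fin.sum_univ_castSucc]
  have h1 (j : Fin e) : ((emb (d := e + 1) h : SO (e + 1)) : Matrix _ _ ℝ) i.castSucc j.castSucc =
      (h : Matrix _ _ ℝ) i j := by
    simp [emb, extMatrix]
  have h2 : ((emb (d := e + 1) h : SO (e + 1)) : Matrix _ _ ℝ) i.castSucc (Fin.last e) = 0 := by
    simp [emb, extMatrix, Fin.ext_iff, i.2.ne]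
  simp only [h1, h2, zero_mul, add_zero]

theorem last_emb {e : ℕ} (h : SO e) (x : EuclideanSpace ℝ (Fin (e + 1))) :
    rotIsometry (emb (d := e + 1) h) x (Fin.last e) = x (Fin.last e) := by
  rw [rotIsometry_apply]
  simp only [Matrix.mulVec, dotProduct, Fin.sum_univ_castSucc]
  have h1 (j : Fin e) : ((emb (d := e + 1) h : SO (e + 1)) : Matrix _ _ ℝ) (Fin.last e) j.castSucc =
      0 := by
    simp [emb, extMatrix, Fin.ext_iff, j.2.ne']
  have h2 : ((emb (d := e + 1) h : SO (e + 1)) : Matrix _ _ ℝ) (Fin.last e) (Fin.last e) = 1 := by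
    simp [emb, extMatrix]
  simp [h1, h2]

theorem initCoords_emb_inv {e : ℕ} (h : SO e) (x : EuclideanSpace ℝ (Fin (e + 1))) :
    initCoords (rotIsometry (emb (d := e + 1) h)⁻¹ x) = rotIsometry h⁻¹ (initCoords x) := by
  apply (rotIsometry h).injective
  rw [← initCoords_emb, rotIsometry_rotIsometry_inv, rotIsometry_rotIsometry_inv]

theorem last_emb_inv {e : ℕ} (h : SO e) (x : EuclideanSpace ℝ (Fin (e + 1))) :
    rotIsometry (emb (d := e + 1) h)⁻¹ x (Fin.last e) = x (Fin.last e) := by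
  rw [← last_emb h, rotIsometry_rotIsometry_inv]

/-- The rotation leaves the last coordinate fixed, so the integrand is a polynomial in it times a
polynomial in the others. If `m ≠ m'` the integral over the smaller sphere vanishes. If `m = m'`
both Gegenbauer factors share their parameter and the weight fits it, so `a ≠ a'` gives zero and `a
= a'` gives one after normalization. -/
theorem sphInner_stepAng {e m m' : ℕ} (he : 2 ≤ e) {F F' : (ℕ → ℝ) → ℂ}
    {f f' : EuclideanSpace ℝ (Fin e) → ℂ} (hf : IsSolid e m F f) (hf' : IsSolid e m' F' f')
    (a a' : ℕ) (h : SO e) :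
    sphInner (e + 1)
        (T (emb (d := e + 1) h) fun x => (Real.sqrt (stepNormSq e m a) : ℂ) *
          stepAng e m a F (angle x.1))
        (fun x => (Real.sqrt (stepNormSq e m' a') : ℂ) * stepAng e m' a' F' (angle x.1)) =
      if m = m' ∧ a = a' then
        ∫ x : Sph e, f (rotIsometry h⁻¹ x.1) * conj (f' x.1) ∂sphMeasure e else 0 := by
  have : NeZero e := ⟨by omega⟩
  have he' : (2 : ℝ) ≤ e := by exact_mod_cast he
  have hint : ∀ x : Sph (e + 1),
      T (emb (d := e + 1) h) (fun x => (Real.sqrt (stepNormSq e m a) : ℂ) *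
          stepAng e m a F (angle x.1)) x *
        conj ((Real.sqrt (stepNormSq e m' a') : ℂ) * stepAng e m' a' F' (angle x.1)) =
      ((Real.sqrt (stepNormSq e m a) * Real.sqrt (stepNormSq e m' a') : ℝ) : ℂ) *
        ((((gegenbauer (((e : ℝ) - 1) / 2 + m) a *
          gegenbauer (((e : ℝ) - 1) / 2 + m') a').eval (x.1 (Fin.last e)) : ℝ) : ℂ) *
        (f (rotIsometry h⁻¹ (initCoords x.1)) * conj (f' (initCoords x.1)))) := by
    intro x
    rw [T, stepAng_angle he hf, stepAng_angle he hf', rot_coe, initCoords_emb_inv, last_emb_inv]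
    simp only [map_mul, Complex.conj_ofReal, Polynomial.eval_mul, Complex.ofReal_mul]
    ring
  unfold sphInner
  simp only [hint]
  rw [integral_const_mul, ((hf.hom.comp_rot h⁻¹).mul hf'.hom.star).integral_sphere_slice]
  by_cases hm : m = m'
  · subst hm
    have harg : ((e : ℝ) + (m + m : ℕ)) / 2 = ((e : ℝ) - 1) / 2 + m + 1 / 2 := by
      push_cast
      ring
    rw [harg]
    by_cases ha : a = a'
    · subst ha
      rw [if_pos ⟨rfl, rfl⟩, ← mul_assoc, ← Complex.ofReal_mul,
        Real.mul_self_sqrt (stepNormSq_nonneg he m a), stepNormSq_mul he, Complex.ofReal_one,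
        one_mul]
    · have hl : 0 < ((e : ℝ) - 1) / 2 + m := by
        have := Nat.cast_nonneg (α := ℝ) m
        linarith
      rw [if_neg (fun h => ha h.2), betaInt_gegenbauer_mul_gegenbauer hl ha]
      simp
  · rw [if_neg (fun h => hm h.1),
      hf.hom.integral_rot_mul_conj_eq_zero hf'.hom hf.orth hf'.orth hm, mul_zero, mul_zero]

theorem matCoeff_eq_integral {e m : ℕ} {k k' : Idx e} {f f' : EuclideanSpace ℝ (Fin e) → ℂ}
    (hf : IsSolid e m (harmonicAng e m k) f) (hf' : IsSolid e m (harmonicAng e m k') f')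
    (h : SO e) :
    matCoeff e m k' k h = ∫ x : Sph e, f (rotIsometry h⁻¹ x.1) * conj (f' x.1) ∂sphMeasure e := by
  refine integral_congr_ae (Filter.Eventually.of_forall fun x => ?_)
  simp only [T, harmonic]
  rw [hf.eq_sphere, hf'.eq_sphere, rot_coe]

theorem sphInner_harmonic_emb {e n n' m m' : ℕ} (he : 3 ≤ e) {k k' : Idx e}
    (hk : k ∈ idxSet e m) (hk' : k' ∈ idxSet e m') (hm : m ≤ n) (hm' : m' ≤ n') (h : SO e) :
    sphInner (e + 1) (T (emb (d := e + 1) h) (harmonic (e + 1) n (consIdx (d := e + 1) m k)))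
        (harmonic (e + 1) n' (consIdx (d := e + 1) m' k')) =
      if n = n' ∧ m = m' then matCoeff e m k' k h else 0 := by
  obtain ⟨a, rfl⟩ := Nat.exists_eq_add_of_le hm
  obtain ⟨a', rfl⟩ := Nat.exists_eq_add_of_le hm'
  obtain ⟨f, hf⟩ := exists_isSolid e m he k hk
  obtain ⟨f', hf'⟩ := exists_isSolid e m' he k' hk'
  have h1 := sphInner_stepAng (by omega) hf hf' a a' h
  unfold harmonic
  rw [harmonicAng_consIdx (by omega), harmonicAng_consIdx (by omega), h1]
  by_cases hmm : m = m'
  · subst hmm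
    by_cases ha : a = a'
    · subst ha
      rw [if_pos ⟨rfl, rfl⟩, if_pos ⟨rfl, rfl⟩, matCoeff_eq_integral hf hf']
    · rw [if_neg (fun h => ha h.2), if_neg (fun h => ha (by omega))]
  · rw [if_neg (fun h => hmm h.1), if_neg (fun h => hmm h.2)]

theorem planeRot_eq_emb (γ : ℝ) : planeRot γ = emb (d := 3) (circRot (-γ)) := by
  apply Subtype.ext
  ext i j
  fin_cases i <;> fin_cases j <;> simp [planeRot, emb, extMatrix, circRot]

theorem circNum_rot_inv (γ : ℝ) (x : EuclideanSpace ℝ (Fin 2)) :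
    circNum (rotIsometry (circRot (-γ))⁻¹ x) = Complex.exp (γ * Complex.I) * circNum x := by
  have h := circNum_rot (-γ) (rotIsometry (circRot (-γ))⁻¹ x)
  rw [rotIsometry_rotIsometry_inv] at h
  rw [h, ← mul_assoc, ← Complex.exp_add]
  simp

theorem sphInner_harmonic_planeRot {n n' : ℕ} {k k' : ℤ} (hk : k.natAbs ≤ n)
    (hk' : k'.natAbs ≤ n') (γ : ℝ) :
    sphInner 3 (T (planeRot γ) (harmonic 3 n fun _ => k)) (harmonic 3 n' fun _ => k') =
      if n = n' ∧ k = k' then Complex.exp (Complex.I * (k : ℂ) * (γ : ℂ)) else 0 := by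
  obtain ⟨a, rfl⟩ := Nat.exists_eq_add_of_le hk
  obtain ⟨a', rfl⟩ := Nat.exists_eq_add_of_le hk'
  have h1 := sphInner_stepAng le_rfl (isSolid_circ k) (isSolid_circ k') a a' (circRot (-γ))
  have h2 (x : Sph 2) : circFun k (rotIsometry (circRot (-γ))⁻¹ x.1) =
      Complex.exp (Complex.I * (k : ℂ) * (γ : ℂ)) * circFun k x.1 := by
    rw [← rot_coe, circFun_eq_zpow, rot_coe, circNum_rot_inv, mul_zpow, ← circFun_eq_zpow,
      ← Complex.exp_int_mul]
    congr 2
    ring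
  simp only [h2, mul_assoc (Complex.exp _)] at h1
  rw [integral_const_mul, integral_circFun_mul_conj] at h1
  unfold harmonic
  rw [harmonicAng_three, harmonicAng_three, planeRot_eq_emb]
  refine h1.trans ?_
  -- The slicing only compares `|k|` with `|k'|`; opposite frequencies are separated by the circle
  -- integral.
  by_cases hkk : k = k'
  · subst hkk
    simp
  · simp [hkk]

/-! ### Matrix coefficients as polynomials -/

/-- Substituting `Aᵀ x` replaces each coordinate by a linear form in the entries of `A`. Taking
coefficients in the ring of continuous functions of `x` separates the two kinds of variables, so
that `x` can be integrated out coefficient by coefficient. -/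
theorem IsHom.exists_mvPolynomial {d n : ℕ} {f : EuclideanSpace ℝ (Fin d) → ℂ}
    (hf : IsHom d n f) :
    ∃ P : MvPolynomial (Fin d × Fin d) C(Sph d, ℂ), P.totalDegree ≤ n ∧
      ∀ (A : Matrix (Fin d) (Fin d) ℝ) (x : Sph d),
        f (WithLp.toLp 2 (A.transpose.mulVec x.1.ofLp)) =
          MvPolynomial.eval (fun ij => ContinuousMap.const (Sph d) (A ij.1 ij.2 : ℂ)) P x := by
  induction hf with
  | const c => exact ⟨MvPolynomial.C (ContinuousMap.const _ c), by simp, by simp⟩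
  | coord i =>
    refine ⟨∑ j, MvPolynomial.C ⟨fun x : Sph d => (x.1 j : ℂ), by fun_prop⟩ *
      MvPolynomial.X (j, i), ?_, ?_⟩
    · refine MvPolynomial.totalDegree_finsetSum_le fun j _ => ?_
      refine (MvPolynomial.totalDegree_mul _ _).trans ?_
      have h1 := MvPolynomial.totalDegree_monomial_le (R := C(Sph d, ℂ))
        (Finsupp.single (j, i) 1) 1
      rw [Finsupp.sum_single_index rfl] at h1
      rw [MvPolynomial.totalDegree_C, zero_add]
      exact h1
    · intro A x
      simp only [Matrix.mulVec, dotProduct, Matrix.transpose_apply, map_sum, map_mul,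
        MvPolynomial.eval_C, MvPolynomial.eval_X, ContinuousMap.coe_sum, Finset.sum_apply,
        ContinuousMap.coe_mul, Pi.mul_apply, ContinuousMap.const_apply, ContinuousMap.coe_mk,
        Complex.ofReal_sum, Complex.ofReal_mul]
      exact Finset.sum_congr rfl fun j _ => mul_comm _ _
  | add _ _ h1 h2 =>
    obtain ⟨P, hP, hP'⟩ := h1
    obtain ⟨Q, hQ, hQ'⟩ := h2
    refine ⟨P + Q, (MvPolynomial.totalDegree_add _ _).trans (max_le hP hQ), fun A x => ?_⟩
    simp only [hP', hQ', map_add, ContinuousMap.add_apply]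
  | mul _ _ h1 h2 =>
    obtain ⟨P, hP, hP'⟩ := h1
    obtain ⟨Q, hQ, hQ'⟩ := h2
    refine ⟨P * Q, (MvPolynomial.totalDegree_mul _ _).trans (add_le_add hP hQ), fun A x => ?_⟩
    simp only [hP', hQ', map_mul, ContinuousMap.mul_apply]

theorem IsHom.isPolySO_integral {d n : ℕ} [NeZero d] {f : EuclideanSpace ℝ (Fin d) → ℂ}
    (hf : IsHom d n f) (q : C(Sph d, ℂ)) :
    IsPolySO d n fun h => ∫ x : Sph d, f (rotIsometry h⁻¹ x.1) * q x ∂sphMeasure d := by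
  obtain ⟨P, hP, hP'⟩ := hf.exists_mvPolynomial
  refine ⟨∑ s ∈ P.support, MvPolynomial.monomial s
    (∫ x : Sph d, P.coeff s x * q x ∂sphMeasure d), ?_, fun h => ?_⟩
  · refine MvPolynomial.totalDegree_finsetSum_le fun s hs => ?_
    exact (MvPolynomial.totalDegree_monomial_le _ _).trans
      ((MvPolynomial.le_totalDegree hs).trans hP)
  · have h1 (x : Sph d) : f (rotIsometry h⁻¹ x.1) * q x =
        ∑ s ∈ P.support, (P.coeff s x * q x) *
          ∏ ij ∈ s.support, ((h : Matrix (Fin d) (Fin d) ℝ) ij.1 ij.2 : ℂ) ^ s ij := by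
      have h2 := hP' h x
      rw [MvPolynomial.eval_eq, ContinuousMap.coe_sum, Finset.sum_apply] at h2
      rw [rotIsometry_apply]
      -- The inverse in the rotation group unfolds to the transpose, so `h2` matches the action of
      -- `h⁻¹` and the result is a polynomial in the entries of `h` itself.
      refine (congrArg (· * q x) h2).trans ?_
      rw [Finset.sum_mul]
      refine Finset.sum_congr rfl fun s _ => ?_
      simp only [ContinuousMap.mul_apply, ContinuousMap.coe_prod, Finset.prod_apply,
        ContinuousMap.pow_apply, ContinuousMap.const_apply]
      ring
    simp only [h1]
    rw [integral_finsetSum _ fun s _ => integrable_sphere (by fun_prop), map_sum]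
    refine Finset.sum_congr rfl fun s _ => ?_
    rw [integral_mul_const, MvPolynomial.eval_monomial, Finsupp.prod]

theorem IsPolySO.mono {d n m : ℕ} {F : SO d → ℂ} (h : IsPolySO d n F) (hnm : n ≤ m) :
    IsPolySO d m F := by
  obtain ⟨p, hp, hp'⟩ := h
  exact ⟨p, hp.trans hnm, hp'⟩

theorem IsPolySO.const_mul {d n : ℕ} {F : SO d → ℂ} (h : IsPolySO d n F) (c : ℂ) :
    IsPolySO d n fun g => c * F g := by
  obtain ⟨p, hp, hp'⟩ := h
  refine ⟨MvPolynomial.C c * p, ?_, fun g => by simp only [hp', map_mul, MvPolynomial.eval_C]⟩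
  refine (MvPolynomial.totalDegree_mul _ _).trans ?_
  rwa [MvPolynomial.totalDegree_C, zero_add]

theorem IsPolySO.sum {d n : ℕ} {ι : Type*} (s : Finset ι) {F : ι → SO d → ℂ}
    (h : ∀ i ∈ s, IsPolySO d n (F i)) : IsPolySO d n fun g => ∑ i ∈ s, F i g := by
  choose! p hp hp' using h
  refine ⟨∑ i ∈ s, p i, MvPolynomial.totalDegree_finsetSum_le hp, fun g => ?_⟩
  rw [map_sum]
  exact Finset.sum_congr rfl fun i hi => hp' i hi g

theorem isPolySO_matCoeff {e m : ℕ} (he : 3 ≤ e) {k k' : Idx e} (hk : k ∈ idxSet e m)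
    (hk' : k' ∈ idxSet e m) : IsPolySO e m fun h => matCoeff e m k' k h := by
  have : NeZero e := ⟨by omega⟩
  obtain ⟨f, hf⟩ := exists_isSolid e m he k hk
  obtain ⟨f', hf'⟩ := exists_isSolid e m he k' hk'
  simp only [matCoeff_eq_integral hf hf']
  exact hf.hom.isPolySO_integral
    ⟨fun x : Sph e => conj (f' x.1), hf'.hom.star.continuous.comp continuous_subtype_val⟩

/-! ### The auto-correlation function -/

theorem kappa_div_eq_zero {q : ℕ} {φ : ℝ → ℝ} (hφ : IsProfile q φ) {N : ℕ} (hN : 1 ≤ N) {n : ℕ}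
    (hn : n ∉ Finset.range (2 * N)) : kappa φ ((n : ℝ) / N) = 0 := by
  apply kappa_eq_zero hφ
  have h1 : (0 : ℝ) < N := by exact_mod_cast hN
  rw [le_div_iff₀ h1]
  rw [Finset.mem_range, not_lt] at hn
  exact_mod_cast hn

/-- The coefficients of the wavelet. -/
def waveletCoeff (d : ℕ) (φ : ℝ → ℝ) (ζ : ℕ → Idx d → ℂ) (N n : ℕ) (k : Idx d) : ℂ :=
  (Real.sqrt (dimHarm d n) : ℂ) * (kappa φ ((n : ℝ) / N) : ℂ) * ζ n k

theorem waveletCoeff_mul_conj (d : ℕ) (φ : ℝ → ℝ) (ζ : ℕ → Idx d → ℂ) (N n : ℕ) (k k' : Idx d) :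
    waveletCoeff d φ ζ N n k * conj (waveletCoeff d φ ζ N n k') =
      (dimHarm d n : ℂ) * (kappa φ ((n : ℝ) / N) : ℂ) ^ 2 * (ζ n k * conj (ζ n k')) := by
  have h1 : (Real.sqrt (dimHarm d n) : ℂ) * (Real.sqrt (dimHarm d n) : ℂ) = (dimHarm d n : ℂ) := by
    rw [← Complex.ofReal_mul, Real.mul_self_sqrt (Nat.cast_nonneg _), Complex.ofReal_natCast]
  unfold waveletCoeff
  rw [map_mul, map_mul, Complex.conj_ofReal, Complex.conj_ofReal, ← h1]
  ring

theorem wavelet_eq_sum {q d : ℕ} {φ : ℝ → ℝ} (hφ : IsProfile q φ) (ζ : ℕ → Idx d → ℂ) {N : ℕ}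
    (hN : 1 ≤ N) (x : Sph d) :
    wavelet d φ ζ N x = ∑ n ∈ Finset.range (2 * N), ∑ k ∈ idxSet d n,
      waveletCoeff d φ ζ N n k * harmonic d n k x := by
  refine tsum_eq_sum fun n hn => ?_
  rw [kappa_div_eq_zero hφ hN hn]
  simp

theorem sphInner_sum {d : ℕ} [NeZero d] {ι : Type*} (s : Finset ι) (c : ι → ℂ)
    (u v : ι → Sph d → ℂ) (hu : ∀ i ∈ s, Continuous (u i)) (hv : ∀ i ∈ s, Continuous (v i)) :
    sphInner d (fun x => ∑ i ∈ s, c i * u i x) (fun x => ∑ i ∈ s, c i * v i x) =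
      ∑ i ∈ s, ∑ j ∈ s, c i * conj (c j) * sphInner d (u i) (v j) := by
  unfold sphInner
  have h1 (x : Sph d) : (∑ i ∈ s, c i * u i x) * conj (∑ i ∈ s, c i * v i x) =
      ∑ i ∈ s, ∑ j ∈ s, c i * conj (c j) * (u i x * conj (v j x)) := by
    rw [map_sum, Finset.sum_mul_sum]
    refine Finset.sum_congr rfl fun i _ => Finset.sum_congr rfl fun j _ => ?_
    rw [map_mul]
    ring
  have h2 : ∀ i ∈ s, ∀ j ∈ s, Continuous fun x => c i * conj (c j) * (u i x * conj (v j x)) :=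
    fun i hi j hj => continuous_const.mul
      ((hu i hi).mul (Complex.continuous_conj.comp (hv j hj)))
  simp only [h1]
  rw [integral_finsetSum _ fun i hi => integrable_sphere
    (continuous_finsetSum _ fun j hj => h2 i hi j hj)]
  refine Finset.sum_congr rfl fun i hi => ?_
  rw [integral_finsetSum _ fun j hj => integrable_sphere (h2 i hi j hj)]
  exact Finset.sum_congr rfl fun j _ => integral_const_mul _ _

theorem continuous_harmonic {d n : ℕ} (hd : 3 ≤ d) {k : Idx d} (hk : k ∈ idxSet d n) :
    Continuous (harmonic d n k) := by
  obtain ⟨f, hf⟩ := exists_isSolid d n hd k hk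
  have : harmonic d n k = fun x => f x.1 := funext fun x => hf.eq_sphere x
  rw [this]
  exact hf.hom.continuous.comp continuous_subtype_val

theorem continuous_rot {d : ℕ} (g : SO d) : Continuous (rot g) :=
  Continuous.subtype_mk ((rotIsometry g).continuous.comp continuous_subtype_val) _

theorem autocorr_eq_sum {q d : ℕ} (hd : 3 ≤ d) {φ : ℝ → ℝ} (hφ : IsProfile q φ)
    (ζ : ℕ → Idx d → ℂ) {N : ℕ} (hN : 1 ≤ N) (g : SO d) :
    autocorr d φ ζ N g = ∑ n ∈ Finset.range (2 * N), ∑ k ∈ idxSet d n,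
      ∑ n' ∈ Finset.range (2 * N), ∑ k' ∈ idxSet d n',
        waveletCoeff d φ ζ N n k * conj (waveletCoeff d φ ζ N n' k') *
          sphInner d (T g (harmonic d n k)) (harmonic d n' k') := by
  have : NeZero d := ⟨by omega⟩
  have h1 : wavelet d φ ζ N = fun x => ∑ p ∈ (Finset.range (2 * N)).sigma fun n => idxSet d n,
      waveletCoeff d φ ζ N p.1 p.2 * harmonic d p.1 p.2 x := by
    funext x
    rw [wavelet_eq_sum hφ ζ hN, Finset.sum_sigma]
  have h2 : T g (wavelet d φ ζ N) = fun x =>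
      ∑ p ∈ (Finset.range (2 * N)).sigma fun n => idxSet d n,
        waveletCoeff d φ ζ N p.1 p.2 * T g (harmonic d p.1 p.2) x := by
    rw [h1]
    rfl
  unfold autocorr
  rw [h2, h1, sphInner_sum]
  · simp only [Finset.sum_sigma]
  · intro p hp
    exact (continuous_harmonic hd (Finset.mem_sigma.1 hp).2).comp (continuous_rot _)
  · intro p hp
    exact continuous_harmonic hd (Finset.mem_sigma.1 hp).2

/-- Inner products of harmonics vanish unless `n = n'` and `m = m'`, which collapses the quadruple
sum. The levels `m > K` contribute nothing by the support condition on `ζ`. -/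
theorem autocorr_emb {q e K : ℕ} (he : 3 ≤ e) {φ : ℝ → ℝ} (hφ : IsProfile q φ)
    {ζ : ℕ → Idx (e + 1) → ℂ} (hζ : IsDirectionality (e + 1) K ζ) {N : ℕ} (hN : 1 ≤ N) (h : SO e) :
    autocorr (e + 1) φ ζ N (emb (d := e + 1) h) = ∑ n ∈ Finset.range (2 * N),
      (dimHarm (e + 1) n : ℂ) * (kappa φ ((n : ℝ) / N) : ℂ) ^ 2 *
        ∑ m ∈ Finset.range (min K n + 1), ∑ k ∈ idxSet e m, ∑ k' ∈ idxSet e m,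
          ζ n (consIdx (d := e + 1) m k) * conj (ζ n (consIdx (d := e + 1) m k')) *
            matCoeff e m k' k h := by
  rw [autocorr_eq_sum (by omega) hφ ζ hN]
  refine Finset.sum_congr rfl fun n hn => ?_
  have hsub : Finset.range (min K n + 1) ⊆ Finset.range (n + 1) := by
    intro m hm
    rw [Finset.mem_range] at hm ⊢
    omega
  rw [sum_idxSet_succ he, Finset.mul_sum]
  symm
  -- Extends the claimed sum from `m ≤ min K n` to `m ≤ n`, to match the branching of the index set.
  rw [← Finset.sum_subset hsub]
  · refine Finset.sum_congr rfl fun m hm => ?_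
    have hmn := Finset.mem_range.1 (hsub hm)
    rw [Finset.mul_sum]
    refine Finset.sum_congr rfl fun k hk => ?_
    rw [Finset.sum_eq_single_of_mem n hn, sum_idxSet_succ he, Finset.sum_eq_single_of_mem m
      (hsub hm), Finset.mul_sum]
    · refine Finset.sum_congr rfl fun k' hk' => ?_
      rw [sphInner_harmonic_emb he hk hk' (by omega) (by omega), if_pos ⟨rfl, rfl⟩,
        waveletCoeff_mul_conj]
      ring
    · intro m' hm' hne
      refine Finset.sum_eq_zero fun k' hk' => ?_
      have hmn' := Finset.mem_range.1 hm'
      rw [sphInner_harmonic_emb he hk hk' (by omega) (by omega), if_neg (fun h => hne h.2.symm),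
        mul_zero]
    · intro n' hn' hne
      refine Finset.sum_eq_zero fun k' hk' => ?_
      obtain ⟨m', k', rfl, hm', hk''⟩ := exists_consIdx he hk'
      rw [sphInner_harmonic_emb he hk hk'' (by omega) hm', if_neg (fun h => hne h.1.symm),
        mul_zero]
  · intro m hm hm'
    rw [Finset.mem_range] at hm hm'
    refine Finset.sum_eq_zero fun k hk => Finset.sum_eq_zero fun n' _ =>
      Finset.sum_eq_zero fun k' _ => ?_
    have h1 : ζ n (consIdx (d := e + 1) m k) = 0 := by
      refine hζ.support n _ ((consIdx_mem (by omega)).2 ⟨by omega, hk⟩) ?_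
      rw [ent_consIdx (by omega)]
      simp only [ent]
      rw [abs_of_nonneg (by positivity)]
      exact_mod_cast (by omega : K < m)
    simp [waveletCoeff, h1]

/-- The rotation acts diagonally on the harmonics, by the phases `e^{ikγ}`, so only squared moduli
of the coefficients remain. -/
theorem autocorr_planeRot {q K : ℕ} {φ : ℝ → ℝ} (hφ : IsProfile q φ)
    {ζ : ℕ → Idx 3 → ℂ} (hζ : IsDirectionality 3 K ζ) {N : ℕ} (hN : 1 ≤ N) (γ : ℝ) :
    autocorr 3 φ ζ N (planeRot γ) = ∑ n ∈ Finset.range (2 * N),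
      ∑ k ∈ Finset.Icc (-(min K n : ℤ)) (min K n : ℤ),
        (dimHarm 3 n : ℂ) * (kappa φ ((n : ℝ) / N) : ℂ) ^ 2 *
          (‖ζ n (fun _ => k)‖ : ℂ) ^ 2 * Complex.exp (Complex.I * (k : ℂ) * (γ : ℂ)) := by
  rw [autocorr_eq_sum le_rfl hφ ζ hN]
  refine Finset.sum_congr rfl fun n hn => ?_
  have hsub : Finset.Icc (-(min K n : ℤ)) (min K n : ℤ) ⊆ Finset.Icc (-(n : ℤ)) n := by
    intro k hk
    rw [Finset.mem_Icc] at hk ⊢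
    omega
  rw [sum_idxSet_three]
  symm
  rw [← Finset.sum_subset hsub]
  · refine Finset.sum_congr rfl fun k hk => ?_
    have hkn := Finset.mem_Icc.1 (hsub hk)
    rw [Finset.sum_eq_single_of_mem n hn, sum_idxSet_three, Finset.sum_eq_single_of_mem k
      (hsub hk)]
    · rw [sphInner_harmonic_planeRot (by omega) (by omega), if_pos ⟨rfl, rfl⟩,
        waveletCoeff_mul_conj, Complex.mul_conj']
    · intro k' hk' hne
      have hkn' := Finset.mem_Icc.1 hk'
      rw [sphInner_harmonic_planeRot (by omega) (by omega), if_neg (fun h => hne h.2.symm),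
        mul_zero]
    · intro n' hn' hne
      rw [sum_idxSet_three]
      refine Finset.sum_eq_zero fun k' hk' => ?_
      have hkn' := Finset.mem_Icc.1 hk'
      rw [sphInner_harmonic_planeRot (by omega) (by omega), if_neg (fun h => hne h.1.symm),
        mul_zero]
  · intro k hk hk'
    rw [Finset.mem_Icc] at hk hk'
    refine Finset.sum_eq_zero fun n' _ => Finset.sum_eq_zero fun k' _ => ?_
    have h1 : ζ n (fun _ => k) = 0 := by
      have habs := Int.abs_eq_natAbs k
      refine hζ.support n _ (mem_idxSet.2 fun j hj => ?_) ?_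
      · obtain rfl : j = 0 := by omega
        have : |k| ≤ (n : ℤ) := abs_le.2 hk
        simpa [ent] using this
      · have : (K : ℤ) < |k| := by omega
        simpa [ent] using this
    simp [waveletCoeff, h1]

end DirWavelet

end

/-! ### The proposition: dimension at least four, and dimension three -/

open DirWavelet
theorem proposition3p2 (q : ℕ) (φ : ℝ → ℝ) (hφ : IsProfile q φ) (K N : ℕ) (hN : 1 ≤ N) :
    -- dimension at least four
    (∀ d : ℕ, 4 ≤ d → ∀ ζ : ℕ → Idx d → ℂ, IsDirectionality d K ζ →
      (∀ h : SO (d - 1),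
        HasSum
          (fun n : ℕ => (dimHarm d n : ℂ) * (kappa φ ((n : ℝ) / N) : ℂ) ^ 2 *
            ∑ m ∈ Finset.range (min K n + 1),
              ∑ k ∈ idxSet (d - 1) m, ∑ k' ∈ idxSet (d - 1) m,
                ζ n (consIdx m k) * (starRingEnd ℂ) (ζ n (consIdx m k')) *
                  matCoeff (d - 1) m k' k h)
          (autocorr d φ ζ N (emb h))) ∧
      IsPolySO (d - 1) K (fun h => autocorr d φ ζ N (emb h))) ∧
    -- dimension three
    (∀ ζ : ℕ → Idx 3 → ℂ, IsDirectionality 3 K ζ →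
      (∀ γ : ℝ,
        HasSum
          (fun n : ℕ => ∑ k ∈ Finset.Icc (-(min K n : ℤ)) (min K n : ℤ),
            (dimHarm 3 n : ℂ) * (kappa φ ((n : ℝ) / N) : ℂ) ^ 2 *
              (‖ζ n (fun _ => k)‖ : ℂ) ^ 2 * Complex.exp (Complex.I * (k : ℂ) * (γ : ℂ)))
          (autocorr 3 φ ζ N (planeRot γ))) ∧
      (fun γ : ℝ => autocorr 3 φ ζ N (planeRot γ)) ∈ trigPoly K) := by
  refine ⟨?_, ?_⟩
  · intro d hd ζ hζ
    obtain ⟨e, rfl⟩ : ∃ e, d = e + 1 := ⟨d - 1, by omega⟩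
    have he : 3 ≤ e := by omega
    refine ⟨fun h => ?_, ?_⟩
    · change SO e at h
      have h1 := autocorr_emb he hφ hζ hN h
      rw [show autocorr (e + 1) φ ζ N (emb h) = _ from h1]
      -- For `n ≥ 2N` the argument `n/N` is at least `2`, where `κ` vanishes.
      refine hasSum_sum_of_ne_finset_zero fun n hn => ?_
      rw [kappa_div_eq_zero hφ hN hn]
      simp
    · change IsPolySO e K fun h => autocorr (e + 1) φ ζ N (emb (d := e + 1) h)
      simp only [autocorr_emb he hφ hζ hN]
      refine IsPolySO.sum _ fun n _ => IsPolySO.const_mul ?_ _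
      refine IsPolySO.sum _ fun m hm => IsPolySO.sum _ fun k hk => IsPolySO.sum _ fun k' hk' => ?_
      have hmK : m ≤ K := by
        have := Finset.mem_range.1 hm
        omega
      -- The degree bound `K` arises here: level `m` contributes degree at most `m`, and `m ≤ min K
      -- n`.
      exact ((isPolySO_matCoeff he hk hk').mono hmK).const_mul _
  · intro ζ hζ
    refine ⟨fun γ => ?_, ?_⟩
    · rw [autocorr_planeRot hφ hζ hN]
      refine hasSum_sum_of_ne_finset_zero fun n hn => ?_
      rw [kappa_div_eq_zero hφ hN hn]
      simp
    · have h1 : (fun γ : ℝ => autocorr 3 φ ζ N (planeRot γ)) =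
          ∑ n ∈ Finset.range (2 * N), ∑ k ∈ Finset.Icc (-(min K n : ℤ)) (min K n : ℤ),
            ((dimHarm 3 n : ℂ) * (kappa φ ((n : ℝ) / N) : ℂ) ^ 2 *
              (‖ζ n (fun _ => k)‖ : ℂ) ^ 2) •
                fun γ : ℝ => Complex.exp (Complex.I * (k : ℂ) * (γ : ℂ)) := by
        funext γ
        rw [autocorr_planeRot hφ hζ hN]
        simp only [Finset.sum_apply, Pi.smul_apply, smul_eq_mul]
      rw [h1]
      refine Submodule.sum_mem _ fun n _ => Submodule.sum_mem _ fun k hk =>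
        Submodule.smul_mem _ _ (Submodule.subset_span ⟨k, ?_, rfl⟩)
      rw [Finset.mem_Icc] at hk
      rw [Set.mem_Icc]
      omega
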